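/- Let $N\ge 1$ be an integer and let $a,\mu,\xi\in\mathbb C$ satisfy $\operatorname{Re}\mu>-1$, $\operatorname{Re}a>-1$, $\operatorname{Re}(\mu+a)>-1$ and $\mu+a\notin\mathbb Z_{\ge 0}$. Let $\langle\,\cdot\,\rangle_{\mathrm{LUE}_N}$ denote the average over $\lambda\in(0,\infty)^N$ with density proportional to $\prod_{l=1}^N\lambda_l^{a}e^{-\lambda_l}\prod_{1\le j<k\le N}(\lambda_k-\lambda_j)^2$, normalised to total mass one, and put $C_{N,a}=\prod_{j=0}^{N-1}\Gamma(j+1)\Gamma(j+a+1)$. For $s>0$ define $$\tilde E_{2,N}((0,s);a,\mu;\xi)=\frac{C_{N,a}}{C_{N,a+\mu}}\Big\langle\prod_{l=1}^N\big(1-\xi\chi_{(0,s)}(\lambda_l)\big)(\lambda_l-s)^\mu\Big\rangle_{\mathrm{LUE}_N},$$ where $\chi_{(0,s)}$ is the indicator function of $(0,s)$ and powers are principal branches, so that $(\lambda-s)^\mu=e^{\pi i\mu}(s-\lambda)^\mu$ for $0<\lambda<s$; and $$W_N(s;a,\mu;\xi)=s\frac{d}{ds}\log\big(s^{-N\mu}\tilde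 E_{2,N}((0,s);a,\mu;\xi)\big),$$ where $\frac{d}{ds}\log F$ means $F'/F$. Then, as $s\to0^+$, $$\tilde E_{2,N}((0,s);a,\mu;\xi)=1-\frac{\mu N}{\mu+a}s+O(s^2)+\frac{\Gamma(\mu+1)\Gamma(a+1)\Gamma(\mu+a+N+1)}{\Gamma^2(\mu+a+2)\Gamma(\mu+a+1)\Gamma(N)}\Big((1-\xi)e^{\pi i\mu}-\frac{\sin\pi a}{\sin\pi(\mu+a)}\Big)s^{\mu+a+1}\{1+O(s)\}+O(s^{2(\mu+a+1)}).$$ Consequently, for all sufficiently small $s>0$ the function $\tilde E_{2,N}$ is differentiable and nonzero, and, as $s\to0^+$, $$W_N(s;a,\mu;\xi)=-N\mu-\frac{\mu N}{\mu+a}s+O(s^2)+\frac{\Gamma(\mu+1)\Gamma(a+1)\Gamma(\mu+a+N+1)}{\Gamma(\mu+a+2)\Gamma^2(\mu+a+1)\Gamma(N)}\Big((1-\xi)e^{\pi i\mu}-\frac{\sin\pi a}{\sin\pi(\mu+a)}\Big)s^{\mu+a+1}\{1+O(s)\}+O(s^{2(\mu+a+1)}).$$ In both expansions the terms $O(s^2)$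 and $O(s)$ stand for functions of $s$ analytic at $0$ with that order of vanishing, and $O(s^{2(\mu+a+1)})$ stands for $s^{2(\mu+a+1)}H(s,s^{\mu+a+1})$ with $H$ analytic at $(0,0)$. -/

import Mathlib

open MeasureTheory Filter Topology Asymptotics

noncomputable section

/-- The (unnormalised) Laguerre weight `∏ λ_l ^ a e^{-λ_l} ∏_{j<k} (λ_k - λ_j)²`,
for a complex exponent `a`. -/
def lueWeight (N : ℕ) (a : ℂ) (x : Fin N → ℝ) : ℂ :=
  (∏ l, ((x l : ℂ) ^ a * Complex.exp (-(x l : ℂ)))) *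
    ∏ j, ∏ k ∈ Finset.Ioi j, ((x k : ℂ) - (x j : ℂ)) ^ 2

/-- The average of `φ` over the Laguerre unitary ensemble of `N` eigenvalues in `(0, ∞)`,
the eigenvalue density being the Laguerre weight normalised to total mass one. -/
def lueAverage (N : ℕ) (a : ℂ) (φ : (Fin N → ℝ) → ℂ) : ℂ :=
  (∫ x in Set.univ.pi (fun _ : Fin N => Set.Ioi (0 : ℝ)), φ x * lueWeight N a x) /
    ∫ x in Set.univ.pi (fun _ : Fin N => Set.Ioi (0 : ℝ)), lueWeight N a x

/-- `C_{N,a} = ∏_{j=0}^{N-1} Γ(j+1) Γ(j+a+1)`. -/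
def lueC (N : ℕ) (a : ℂ) : ℂ :=
  ∏ j ∈ Finset.range N, Complex.Gamma ((j : ℂ) + 1) * Complex.Gamma ((j : ℂ) + a + 1)

/-- `Ẽ_{2,N}((0,s); a, μ; ξ)`. The power `(λ - s) ^ μ` is the principal branch, so that
`(λ - s) ^ μ = e^{π i μ} (s - λ) ^ μ` for `0 < λ < s`. -/
def lueE (N : ℕ) (a μ ξ : ℂ) (s : ℝ) : ℂ :=
  lueC N a / lueC N (a + μ) *
    lueAverage N a (fun x => ∏ l,
      ((1 - ξ * (Set.Ioo 0 s).indicator (fun _ => (1 : ℂ)) (x l)) * ((x l - s : ℝ) : ℂ) ^ μ))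

/-- `W_N(s; a, μ; ξ) = s (d/ds) log (s ^ (-N μ) Ẽ_{2,N})`; the derivative of the logarithm is the
logarithmic derivative `F' / F`, which does not depend on a branch. -/
def lueW (N : ℕ) (a μ ξ : ℂ) (s : ℝ) : ℂ :=
  (s : ℂ) * logDeriv (fun t : ℝ => (t : ℂ) ^ (-((N : ℂ) * μ)) * lueE N a μ ξ t) s

/-- The expansion, as `s → 0⁺`,
`F(s) = c₀ + c₁ s + O(s²) + K s^κ {1 + O(s)} + O(s^{2κ})`,
in which the terms `O(s²)` and `O(s)` are analytic functions of `s` at `0`, and the remainder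
`O(s^{2κ})` is `s^{2κ}` times an analytic function of the pair `(s, s^κ)` at `(0, 0)`.
(Were the error terms arbitrary functions, `O(s²)` would swallow the term in `s^κ` if `Re κ ≥ 2`,
and `O(s^{2κ})` would swallow the term in `s` if `Re κ ≤ 1 / 2`.) -/
def HasSmallExpansion (κ c₀ c₁ K : ℂ) (F : ℝ → ℂ) : Prop :=
  ∃ (f g : ℂ → ℂ) (H : ℂ × ℂ → ℂ) (r : ℝ → ℂ),
    AnalyticAt ℂ f 0 ∧ f =O[𝓝 0] (fun z => z ^ 2) ∧
    AnalyticAt ℂ g 0 ∧ g =O[𝓝 0] (fun z => z) ∧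
    AnalyticAt ℂ H (0, 0) ∧
    (∀ᶠ s : ℝ in 𝓝[>] 0, r s = (s : ℂ) ^ (2 * κ) * H ((s : ℂ), (s : ℂ) ^ κ)) ∧
    r =O[𝓝[>] 0] (fun s : ℝ => (s : ℂ) ^ (2 * κ)) ∧
    ∀ᶠ s : ℝ in 𝓝[>] 0,
      F s = c₀ + c₁ * s + f s + K * (s : ℂ) ^ κ * (1 + g s) + r s

end

/-! By Andréief's identity `lueE` equals the N × N Hankel determinant of the moments of w(x) = (1 -
ξχ)(x - s)^μ x^a e^{-x}, divided by C_{N,a+μ} (`lueE_eq_det`). The problem thus reduces to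
one-dimensional integrals.

Put κ = a + μ + 1, which is not an integer. For small s > 0 every moment has the exact form ∫ x^n w
= A_n(s) + β s^κ · s^n B_n(s), where A_n and B_n are convergent power series and β does not depend
on n (`integral_deformedWeight`). To see this, substitute x = s v and cut at v = 2. On (0, 2) the
exponential is expanded in powers of s v. On (2, ∞) the binomial series of (1 - 1/v)^μ converges
uniformly and leaves incomplete Gamma integrals. Their complete Gamma values Γ(κ + n - k) make up
A_n. All other terms combine into finite parts of beta integrals over (0, ∞) with exponent c = a + n
+ m at the origin; a contiguous relation in c reduces them to c = a, and this common factor is β.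
The reflection formula turns β into the sine quotient of the theorem (`totBeta_eq`).

The determinant is then a polynomial in w = s^κ with coefficients analytic in s, hence P(s) + β w
Q(s) + w² H (`HasJet`, `exists_lueE_expansion`). Only P(0), P'(0) and Q(0) have to be computed. P(0)
is a Hankel determinant of Gamma values and equals C_{N,a+μ}. In P'(0) all row replacements but one
produce repeated rows. Q(0) is the minor left after deleting the first row and column, because the
singular matrix at s = 0 has a single nonzero entry. The expansion of `lueW` follows by dividing two
expansions of this type (`hasSmallExpansion_logDeriv`). -/

noncomputable section

/-! ### Andréief's identity and Hankel determinants of Gamma values -/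

/-- **Andréief's identity** for the square of the Vandermonde determinant. -/
theorem integral_prod_mul_vandermonde_sq (N : ℕ) (ν : Measure ℝ) [SigmaFinite ν] (w : ℝ → ℂ)
    (hw : ∀ n : ℕ, Integrable (fun x : ℝ => (x : ℂ) ^ n * w x) ν) :
    ∫ x : Fin N → ℝ, (∏ l, w (x l)) * ∏ j, ∏ k ∈ Finset.Ioi j, ((x k : ℂ) - (x j : ℂ)) ^ 2
        ∂(Measure.pi fun _ => ν) =
      (N.factorial : ℂ) * (Matrix.of fun j k : Fin N =>
        ∫ x, (x : ℂ) ^ ((j : ℕ) + k) * w x ∂ν).det := by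
  have key : ∀ x : Fin N → ℝ,
      (∏ l, w (x l)) * ∏ j, ∏ k ∈ Finset.Ioi j, ((x k : ℂ) - (x j : ℂ)) ^ 2 =
      ∑ σ : Equiv.Perm (Fin N), ∑ τ : Equiv.Perm (Fin N),
        ((Equiv.Perm.sign σ : ℤ) : ℂ) * ((Equiv.Perm.sign τ : ℤ) : ℂ) *
          ∏ i, ((x i : ℂ) ^ ((σ i : ℕ) + τ i) * w (x i)) := by
    intro x
    have hdet := Matrix.det_vandermonde (fun i => (x i : ℂ))
    rw [← Matrix.det_transpose, Matrix.det_apply'] at hdet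
    simp only [Finset.prod_pow]
    rw [← hdet, pow_two, Finset.sum_mul_sum, Finset.mul_sum]
    simp only [Finset.mul_sum, Matrix.transpose_apply, Matrix.vandermonde_apply]
    refine Finset.sum_congr rfl fun σ _ => Finset.sum_congr rfl fun τ _ => ?_
    simp only [pow_add, Finset.prod_mul_distrib]
    ring
  simp_rw [key]
  have hint : ∀ σ τ : Equiv.Perm (Fin N), Integrable (fun x : Fin N → ℝ =>
      ((Equiv.Perm.sign σ : ℤ) : ℂ) * ((Equiv.Perm.sign τ : ℤ) : ℂ) *
          ∏ i, ((x i : ℂ) ^ ((σ i : ℕ) + τ i) * w (x i))) (Measure.pi fun _ => ν) := by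
    intro σ τ
    refine Integrable.const_mul ?_ _
    exact Integrable.fintype_prod (f := fun i (y : ℝ) => (y : ℂ) ^ ((σ i : ℕ) + τ i) * w y)
      (fun i => hw _)
  rw [integral_finsetSum _ fun σ _ => integrable_finsetSum _ fun τ _ => hint σ τ]
  simp_rw [integral_finsetSum _ fun τ _ => hint _ τ, integral_const_mul]
  have hprod : ∀ σ τ : Equiv.Perm (Fin N),
      ∫ x : Fin N → ℝ, ∏ i, ((x i : ℂ) ^ ((σ i : ℕ) + τ i) * w (x i)) ∂(Measure.pi fun _ => ν) =
      ∏ i, ∫ y, (y : ℂ) ^ ((σ i : ℕ) + τ i) * w y ∂ν := fun σ τ =>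
    integral_fintype_prod_eq_prod (fun i (y : ℝ) => (y : ℂ) ^ ((σ i : ℕ) + τ i) * w y)
  simp_rw [hprod]
  set M : Matrix (Fin N) (Fin N) ℂ := Matrix.of fun j k : Fin N =>
        ∫ x, (x : ℂ) ^ ((j : ℕ) + k) * w x ∂ν with hM
  -- For fixed σ the sum over τ is sign(σ) times the determinant of M with rows permuted by σ, that
  -- is det M. The N! permutations σ contribute equally.
  have hσ : ∀ σ : Equiv.Perm (Fin N), ∑ τ : Equiv.Perm (Fin N),
      ((Equiv.Perm.sign σ : ℤ) : ℂ) * ((Equiv.Perm.sign τ : ℤ) : ℂ) *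
        ∏ i, ∫ y, (y : ℂ) ^ ((σ i : ℕ) + τ i) * w y ∂ν = M.det := by
    intro σ
    have h1 := Matrix.det_permute σ M
    rw [← Matrix.det_transpose, Matrix.det_apply'] at h1
    simp_rw [mul_assoc, ← Finset.mul_sum]
    have h2 : ∑ τ : Equiv.Perm (Fin N), ((Equiv.Perm.sign τ : ℤ) : ℂ) *
        ∏ i, ∫ y, (y : ℂ) ^ ((σ i : ℕ) + τ i) * w y ∂ν =
        ((Equiv.Perm.sign σ : ℤ) : ℂ) * M.det := by
      rw [← h1]; rfl
    rw [h2, ← mul_assoc, ← Int.cast_mul, ← Units.val_mul, Int.units_mul_self]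
    simp
  simp_rw [hσ]
  simp [Fintype.card_perm]

/-- `Γ(x + k) = Γ(x) (x)_k` away from the poles. -/
theorem Gamma_add_nat_eq (x : ℂ) (hx : ∀ m : ℕ, x ≠ -m) (k : ℕ) :
    Complex.Gamma (x + k) = Complex.Gamma x * (ascPochhammer ℂ k).eval x := by
  induction k with
  | zero => simp
  | succ k ih =>
    have h : x + k ≠ 0 := fun h => hx k (eq_neg_of_add_eq_zero_left h)
    rw [Nat.cast_succ, ← add_assoc, Complex.Gamma_add_one _ h, ih, ascPochhammer_succ_eval]
    ring

/-- Pulling Γ(x_j) out of row j leaves the rising factorials (x_j)_k. These are monic of degree k in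
x_j, so the remaining determinant is that of Vandermonde. -/
theorem det_Gamma_add {N : ℕ} (x : Fin N → ℂ) (hx : ∀ i, ∀ m : ℕ, x i ≠ -m) :
    (Matrix.of fun j k : Fin N => Complex.Gamma (x j + (k : ℕ))).det =
      (∏ j, Complex.Gamma (x j)) * ∏ i, ∏ j ∈ Finset.Ioi i, (x j - x i) := by
  have h1 : (Matrix.of fun j k : Fin N => Complex.Gamma (x j + (k : ℕ))) =
      Matrix.of fun j k : Fin N => Complex.Gamma (x j) *
        (Matrix.of fun j k : Fin N => (ascPochhammer ℂ (k : ℕ)).eval (x j)) j k := by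
    ext j k
    simp [Gamma_add_nat_eq (x j) (hx j)]
  rw [h1, Matrix.det_mul_column, ← Matrix.det_vandermonde,
    Matrix.det_eval_matrixOfPolynomials_eq_det_vandermonde x
      (fun k => ascPochhammer ℂ (k : ℕ)) (fun i => ascPochhammer_natDegree ℂ _)
      (fun i => monic_ascPochhammer ℂ _)]

theorem prod_Ioi_sub_eq (N : ℕ) :
    ∏ i : Fin N, ∏ j ∈ Finset.Ioi i, (((j : ℕ) : ℂ) - ((i : ℕ) : ℂ)) =
      ∏ j ∈ Finset.range N, Complex.Gamma ((j : ℂ) + 1) := by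
  cases N with
  | zero => simp
  | succ n =>
    have h := Matrix.det_vandermonde_id_eq_superFactorial (R := ℂ) n
    rw [Matrix.det_vandermonde] at h
    rw [h, ← Nat.prod_range_succ_factorial n]
    push_cast
    exact Finset.prod_congr rfl fun j _ => (Complex.Gamma_nat_eq_factorial j).symm

/-- The Hankel determinant of the Laguerre moments. -/
theorem det_Gamma_hankel (N : ℕ) (y : ℂ) (hy : ∀ m : ℕ, y ≠ -m) :
    (Matrix.of fun j k : Fin N => Complex.Gamma (y + ((j : ℕ) + (k : ℕ) : ℕ))).det =
      ∏ j ∈ Finset.range N, Complex.Gamma ((j : ℂ) + 1) * Complex.Gamma ((j : ℂ) + y) := by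
  have h := det_Gamma_add (fun j : Fin N => y + ((j : ℕ) : ℂ)) (fun i m h => hy (i + m) (by
    push_cast; linear_combination h))
  have e : (Matrix.of fun j k : Fin N => Complex.Gamma (y + ((j : ℕ) + (k : ℕ) : ℕ))) =
      Matrix.of fun j k : Fin N => Complex.Gamma (y + ((j : ℕ) : ℂ) + (k : ℕ)) := by
    ext j k; simp [add_assoc]
  rw [e, h]
  simp only [add_sub_add_left_eq_sub, prod_Ioi_sub_eq]
  rw [Finset.prod_mul_distrib, mul_comm, ← Fin.prod_univ_eq_prod_range
    (fun j => Complex.Gamma ((j : ℂ) + y))]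
  simp [add_comm]

theorem hasDerivAt_det {N : ℕ} {M : ℂ → Matrix (Fin N) (Fin N) ℂ} {M' : Matrix (Fin N) (Fin N) ℂ}
    {z : ℂ} (h : ∀ j k, HasDerivAt (fun z => M z j k) (M' j k) z) :
    HasDerivAt (fun z => (M z).det) (∑ i, ((M z).updateRow i (M' i)).det) z := by
  have h1 : ∀ σ : Equiv.Perm (Fin N), HasDerivAt
      (fun z => ((Equiv.Perm.sign σ : ℤ) : ℂ) * ∏ i, M z (σ i) i)
      (((Equiv.Perm.sign σ : ℤ) : ℂ) *
        ∑ i, (∏ j ∈ Finset.univ.erase i, M z (σ j) j) • M' (σ i) i) z :=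
    fun σ => (HasDerivAt.fun_finsetProd fun i _ => h (σ i) i).const_mul _
  have h2 := HasDerivAt.fun_sum fun σ (_ : σ ∈ Finset.univ) => h1 σ
  simp_rw [Matrix.det_apply']
  refine h2.congr_deriv ?_
  rw [Finset.sum_comm]
  refine Finset.sum_congr rfl fun σ _ => ?_
  rw [← Finset.mul_sum]
  congr 1
  -- The product rule on Leibniz's formula differentiates one column i at a time. Reindexing by r =
  -- σ i turns this into a sum over rows.
  rw [← Equiv.sum_comp σ (fun r => ∏ i, (M z).updateRow r (M' r) (σ i) i)]
  refine Finset.sum_congr rfl fun i _ => ?_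
  rw [← Finset.mul_prod_erase _ _ (Finset.mem_univ i), Matrix.updateRow_self, smul_eq_mul,
    mul_comm (M' _ _)]
  congr 1
  refine Finset.prod_congr rfl fun j hj => ?_
  rw [Matrix.updateRow_ne]
  exact fun h => (Finset.ne_of_mem_erase hj) (σ.injective h)

/-- The sum of the determinants in which one row of the shifted Hankel matrix `Γ(y + 1 + j + k)` is
replaced by the corresponding row of `Γ(y + j + k)`. -/
theorem sum_det_updateRow_Gamma_hankel (N : ℕ) (hN : 1 ≤ N) (y : ℂ) (hy : ∀ m : ℕ, y ≠ -m) :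
    ∑ i : Fin N, ((Matrix.of fun j k : Fin N =>
      Complex.Gamma (y + 1 + ((j : ℕ) + (k : ℕ) : ℕ))).updateRow i
        (fun k => Complex.Gamma (y + ((i : ℕ) + (k : ℕ) : ℕ)))).det =
    N / y * ∏ j ∈ Finset.range N, Complex.Gamma ((j : ℂ) + 1) * Complex.Gamma ((j : ℂ) + (y + 1)) := by
  obtain ⟨n, rfl⟩ : ∃ n, N = n + 1 := ⟨N - 1, by omega⟩
  have hy0 : y ≠ 0 := by simpa using hy 0
  -- For i ≥ 1 the inserted row Γ(y + i + k) coincides with row i - 1 of the shifted matrix, so only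
  -- the replacement of row 0 survives. Its nodes are y, y + 2, …, y + N.
  rw [Fin.sum_univ_succ, Finset.sum_eq_zero (s := (Finset.univ : Finset (Fin n))), add_zero]
  · set x : Fin (n + 1) → ℂ := Fin.cons y fun j => y + 1 + ((j : ℕ) + 1 : ℕ) with hxdef
    have hx : ∀ i, ∀ m : ℕ, x i ≠ -m := by
      intro i m
      refine Fin.cases (hy m) (fun j h => hy (j + 2 + m) ?_) i
      simp only [hxdef, Fin.cons_succ] at h
      push_cast at h ⊢
      linear_combination h
    have hy1 : ∀ m : ℕ, y + 1 ≠ -m := fun m h => hy (m + 1) (by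
      push_cast; linear_combination h)
    have e : (Matrix.of fun j k : Fin (n + 1) =>
      Complex.Gamma (y + 1 + ((j : ℕ) + (k : ℕ) : ℕ))).updateRow 0
        (fun k => Complex.Gamma (y + (((0 : Fin (n + 1)) : ℕ) + (k : ℕ) : ℕ))) =
        Matrix.of fun j k : Fin (n + 1) => Complex.Gamma (x j + (k : ℕ)) := by
      ext j k
      refine Fin.cases ?_ (fun j => ?_) j
      · simp [hxdef]
      · rw [Matrix.updateRow_ne (Fin.succ_ne_zero j)]
        simp [hxdef, add_assoc]
    rw [e, det_Gamma_add x hx, ← det_Gamma_hankel _ _ hy1]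
    have e2 : (Matrix.of fun j k : Fin (n + 1) =>
        Complex.Gamma (y + 1 + ((j : ℕ) + (k : ℕ) : ℕ))) =
        Matrix.of fun j k : Fin (n + 1) => Complex.Gamma ((y + 1 + (j : ℕ)) + (k : ℕ)) := by
      ext j k; simp [add_assoc]
    rw [e2, det_Gamma_add (fun j : Fin (n + 1) => y + 1 + (j : ℕ)) (fun i m h => hy1 (i + m) (by
      push_cast; linear_combination h))]
    simp only [Fin.prod_univ_succ, Fin.Ioi_zero_eq_map, Fin.prod_Ioi_succ, Finset.prod_map,
      Fin.coe_succEmb, hxdef, Fin.cons_zero, Fin.cons_succ, Fin.val_zero, Nat.cast_zero, add_zero,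
      Fin.val_succ, Complex.Gamma_add_one y hy0]
    -- The differences from the first node are 2, …, n + 1 instead of 1, …, n, which gives the
    -- factor N = n + 1. The factor 1/y comes from Γ(y + 1) = yΓ(y).
    have e3 : ∏ j : Fin n, (y + 1 + ((j : ℕ) + 1 : ℕ) - y) =
        (n + 1) * ∏ j : Fin n, (y + 1 + ((j : ℕ) + 1 : ℕ) - (y + 1)) := by
      rw [Fin.prod_univ_eq_prod_range (fun j => y + 1 + (j + 1 : ℕ) - y),
        Fin.prod_univ_eq_prod_range (fun j => y + 1 + (j + 1 : ℕ) - (y + 1))]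
      clear * -
      induction n with
      | zero => simp
      | succ n ih =>
        rw [Finset.prod_range_succ, ih, Finset.prod_range_succ]
        push_cast
        ring
    rw [e3]
    push_cast
    field_simp
  · intro i _
    refine Matrix.det_zero_of_row_eq (i := i.succ) (j := i.castSucc) ?_ ?_
    · exact (Fin.castSucc_lt_succ).ne'
    · rw [Matrix.updateRow_self, Matrix.updateRow_ne (Fin.castSucc_lt_succ).ne]
      ext k
      simp only [Matrix.of_apply, Fin.val_succ, Fin.val_castSucc]
      push_cast
      ring_nf

/-! ### The binomial series and scalar power series -/

theorem hasSum_of_forall_eq {ι : Type*} {f g : ι → ℂ} {a : ℂ} (h : HasSum f a)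
    (e : ∀ i, g i = f i) : HasSum g a := (funext e : g = f) ▸ h

/-- The coefficients of the power series of `(1 - x) ^ μ`. -/
def altBinom (μ : ℂ) (k : ℕ) : ℂ := (-1) ^ k * Ring.choose μ k

theorem altBinom_zero (μ : ℂ) : altBinom μ 0 = 1 := by simp [altBinom]

theorem altBinom_succ (μ : ℂ) (k : ℕ) :
    ((k : ℂ) + 1) * altBinom μ (k + 1) = (k - μ) * altBinom μ k := by
  simp only [altBinom, Ring.choose_eq_smul, descPochhammer_succ_right, Polynomial.smeval_mul,
    Polynomial.smeval_sub, Polynomial.smeval_X, Polynomial.smeval_natCast, Nat.factorial_succ,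
    pow_succ, smul_eq_mul]
  have h1 : ((k.factorial : ℕ) : ℂ) ≠ 0 := by exact_mod_cast k.factorial_ne_zero
  have h2 : (k : ℂ) + 1 ≠ 0 := by exact_mod_cast k.succ_ne_zero
  push_cast
  field_simp
  simp
  ring

theorem altBinom_one (μ : ℂ) : altBinom μ 1 = -μ := by
  have := altBinom_succ μ 0
  simpa [altBinom_zero] using this

theorem hasSum_altBinom (μ : ℂ) {x : ℂ} (hx : ‖x‖ < 1) :
    HasSum (fun k => altBinom μ k * x ^ k) ((1 - x) ^ μ) := by
  have h := (Complex.one_add_cpow_hasFPowerSeriesOnBall_zero (a := μ)).hasSum (y := -x) (by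
    simpa [← ENNReal.ofReal_one, Metric.eball_ofReal] using hx)
  rw [zero_add, ← sub_eq_add_neg] at h
  refine hasSum_of_forall_eq h fun k => ?_
  rw [binomialSeries_apply, List.ofFn_const, List.prod_replicate, neg_pow x, smul_eq_mul]
  simp only [altBinom]
  ring

theorem summable_norm_altBinom (μ : ℂ) {r : ℝ} (h0 : 0 ≤ r) (hr : r < 1) :
    Summable fun k => ‖altBinom μ k‖ * r ^ k := by
  lift r to NNReal using h0
  have h := (binomialSeries ℂ μ).summable_norm_mul_pow (r := r) (lt_of_lt_of_le (by
    exact_mod_cast hr) binomialSeries_radius_ge_one)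
  convert h using 2 with k
  simp [altBinom, binomialSeries]

theorem hasFPowerSeriesAt_tsum_pow {u : ℕ → ℂ} {r : ℝ} (hr : 0 < r)
    (hu : Summable fun k => ‖u k‖ * r ^ k) :
    HasFPowerSeriesAt (fun z => ∑' k, u k * z ^ k) (FormalMultilinearSeries.ofScalars ℂ u) 0 := by
  lift r to NNReal using hr.le
  have h1 : (r : ENNReal) ≤ (FormalMultilinearSeries.ofScalars ℂ u).radius := by
    refine FormalMultilinearSeries.le_radius_of_summable_norm _ ?_
    simpa using hu
  have h2 : 0 < (FormalMultilinearSeries.ofScalars ℂ u).radius :=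
    lt_of_lt_of_le (by exact_mod_cast hr) h1
  convert (FormalMultilinearSeries.hasFPowerSeriesOnBall _ h2).hasFPowerSeriesAt using 1
  ext z
  simp [FormalMultilinearSeries.sum, FormalMultilinearSeries.ofScalars, smul_eq_mul]

theorem hasDerivAt_tsum_pow {u : ℕ → ℂ} {r : ℝ} (hr : 0 < r)
    (hu : Summable fun k => ‖u k‖ * r ^ k) :
    HasDerivAt (fun z => ∑' k, u k * z ^ k) (u 1) 0 := by
  simpa [FormalMultilinearSeries.ofScalars] using (hasFPowerSeriesAt_tsum_pow hr hu).hasDerivAt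

theorem tsum_pow_zero (u : ℕ → ℂ) : ∑' k, u k * (0 : ℂ) ^ k = u 0 := by
  rw [tsum_eq_single 0] <;> simp +contextual

/-! ### Non-integral exponents and the incomplete Gamma integral -/

/-- A single δ bounds from below all the denominators κ ± m, κ - k + m of the later series, and so
gives majorants uniform in the indices. -/
theorem exists_le_norm_add_int {κ : ℂ} (hκ : ∀ n : ℤ, κ ≠ n) :
    ∃ δ > 0, ∀ n : ℤ, δ ≤ ‖κ + n‖ := by
  by_cases him : κ.im = 0
  · refine ⟨|κ.re - round κ.re|, abs_pos.2 fun h => hκ (round κ.re) ?_, fun n => ?_⟩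
    · apply Complex.ext
      · simpa using sub_eq_zero.1 h
      · simpa using him
    · refine le_trans ?_ (Complex.abs_re_le_norm _)
      simpa using round_le κ.re (-n)
  · refine ⟨|κ.im|, abs_pos.2 him, fun n => ?_⟩
    simpa using Complex.abs_im_le_norm (κ + n)

/-- Boundedness of S gives the majorant ‖f‖ (2‖z‖)^m / m!, so integrability of f is enough and
endpoint singularities are allowed. -/
theorem hasSum_integral_mul_exp {S : Set ℝ} (hS : MeasurableSet S) (hS2 : S ⊆ Set.Icc 0 2)
    {f : ℝ → ℂ} (hf : IntegrableOn f S) (z : ℂ) :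
    HasSum (fun m : ℕ => (-z) ^ m / m.factorial * ∫ v in S, f v * (v : ℂ) ^ m)
      (∫ v in S, f v * Complex.exp (-(z * v))) := by
  have key : HasSum (fun m : ℕ => ∫ v in S, f v * ((-z * v) ^ m / m.factorial))
      (∫ v in S, f v * Complex.exp (-(z * v))) := by
    refine hasSum_integral_of_dominated_convergence
      (fun m v => ‖f v‖ * ((‖z‖ * 2) ^ m / m.factorial)) (fun m => ?_) (fun m => ?_) ?_ ?_ ?_
    · exact hf.aestronglyMeasurable.mul (Continuous.aestronglyMeasurable (by fun_prop))
    · filter_upwards [ae_restrict_mem hS] with v hv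
      have := hS2 hv
      rw [norm_mul, norm_div, norm_pow, norm_mul, norm_neg, Complex.norm_real,
        Real.norm_of_nonneg this.1, Complex.norm_natCast]
      gcongr
      exacts [mul_nonneg (norm_nonneg _) this.1, this.2]
    · exact ae_of_all _ fun v => (Real.summable_pow_div_factorial _).mul_left _
    · simp_rw [tsum_mul_left]
      exact hf.norm.mul_const _
    · refine ae_of_all _ fun v => ?_
      rw [← neg_mul, Complex.exp_eq_exp_ℂ]
      exact (NormedSpace.expSeries_div_hasSum_exp (-z * v)).mul_left _
  refine hasSum_of_forall_eq key fun m => ?_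
  rw [← integral_const_mul]
  refine integral_congr_ae (ae_of_all _ fun v => ?_)
  simp only [mul_pow]
  ring

theorem summable_lowerGamma {p : ℂ} (hp : ∀ n : ℤ, p ≠ n) (z : ℂ) :
    Summable fun m : ℕ => (-z) ^ m / m.factorial * ((2 : ℂ) ^ (p + m) / (p + m)) := by
  obtain ⟨δ, hδ, h⟩ := exists_le_norm_add_int hp
  refine Summable.of_norm_bounded ((Real.summable_pow_div_factorial (‖z‖ * 2)).mul_left
    (‖(2 : ℂ) ^ p‖ / δ)) fun m => ?_
  have hm := h m
  push_cast at hm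
  rw [Complex.cpow_add _ _ two_ne_zero, Complex.cpow_natCast]
  simp only [norm_mul, norm_div, norm_pow, norm_neg, Complex.norm_natCast, Complex.norm_ofNat]
  calc ‖z‖ ^ m / m.factorial * (‖(2 : ℂ) ^ p‖ * 2 ^ m / ‖p + m‖)
      ≤ ‖z‖ ^ m / m.factorial * (‖(2 : ℂ) ^ p‖ * 2 ^ m / δ) := by gcongr
    _ = _ := by ring

theorem integrableOn_cpow_mul_exp_Ioi_two (q : ℂ) {s : ℝ} (hs : 0 < s) :
    IntegrableOn (fun v : ℝ => (v : ℂ) ^ q * Complex.exp (-(s * v))) (Set.Ioi 2) := by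
  have hcont : ContinuousOn (fun v : ℝ => (v : ℂ) ^ q * Complex.exp (-(s * v))) (Set.Ici 2) := by
    refine ContinuousOn.mul (fun v hv => ?_) (by fun_prop)
    have : (0 : ℝ) < v := lt_of_lt_of_le two_pos hv
    exact (Complex.continuousAt_ofReal_cpow_const v q (Or.inr this.ne')).continuousWithinAt
  have h := integrable_of_isBigO_exp_neg (f := fun v : ℝ => v ^ q.re * Real.exp (-(s * v)))
    (a := 2) (b := s / 2) (by positivity) ?_ ?_
  · refine h.mono' (hcont.mono Set.Ioi_subset_Ici_self |>.aestronglyMeasurable measurableSet_Ioi) ?_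
    filter_upwards [ae_restrict_mem measurableSet_Ioi] with v hv
    have : (0 : ℝ) < v := lt_trans two_pos hv
    rw [norm_mul, Complex.norm_cpow_eq_rpow_re_of_pos this, Complex.norm_exp]
    simp
  · refine ContinuousOn.mul (fun v hv => ?_) (by fun_prop)
    have : (0 : ℝ) < v := lt_of_lt_of_le two_pos hv
    exact (Real.continuousAt_rpow_const v _ (Or.inl this.ne')).continuousWithinAt
  · have := (isLittleO_rpow_exp_pos_mul_atTop q.re (half_pos hs)).isBigO.mul
      (isBigO_refl (fun v : ℝ => Real.exp (-(s * v))) atTop)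
    refine this.congr_right fun v => ?_
    rw [← Real.exp_add]
    ring_nf

/-- The convergent expansion of the incomplete Gamma integral over `(2, ∞)`. -/
theorem integral_Ioi_two_cpow_mul_exp {s : ℝ} (hs : 0 < s) {p : ℂ} (hp : ∀ n : ℤ, p ≠ n) :
    ∫ v in Set.Ioi (2 : ℝ), (v : ℂ) ^ (p - 1) * Complex.exp (-(s * v)) =
      (s : ℂ) ^ (-p) * Complex.Gamma p -
        ∑' m : ℕ, (-(s : ℂ)) ^ m / m.factorial * ((2 : ℂ) ^ (p + m) / (p + m)) := by
  have hs0 : (s : ℂ) ≠ 0 := by exact_mod_cast hs.ne'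
  -- Induction on j > -Re p: integration by parts replaces p by p + 1 until Re p > 0. There the
  -- formula is the complete Gamma integral minus the integral over (0, 2], expanded termwise.
  obtain ⟨j, hj⟩ := exists_nat_gt (-p.re)
  induction j generalizing p with
  | zero =>
    have hre : 0 < p.re := by simpa using hj
    have h1 := Complex.integral_cpow_mul_exp_neg_mul_Ioi hre hs
    have hI : IntegrableOn (fun v : ℝ => (v : ℂ) ^ (p - 1)) (Set.Ioc 0 2) :=
      (intervalIntegrable_iff_integrableOn_Ioc_of_le two_pos.le).1
        (intervalIntegral.intervalIntegrable_cpow' (by simpa using hre))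
    have h2 := hasSum_integral_mul_exp measurableSet_Ioc
      (Set.Ioc_subset_Icc_self) hI (s : ℂ)
    have hI2 : IntegrableOn (fun v : ℝ => (v : ℂ) ^ (p - 1) * Complex.exp (-(s * v)))
        (Set.Ioc 0 2) := by
      have := (hI.continuousOn_mul_of_subset (K := Set.Icc 0 2)
        (g := fun v : ℝ => Complex.exp (-(s * v))) (by fun_prop)
        isCompact_Icc measurableSet_Ioc Set.Ioc_subset_Icc_self)
      simpa only [mul_comm] using this
    have h3 : ∀ m : ℕ, ∫ v in Set.Ioc (0 : ℝ) 2, (v : ℂ) ^ (p - 1) * (v : ℂ) ^ m =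
        (2 : ℂ) ^ (p + m) / (p + m) := by
      intro m
      have h4 : ∫ v in Set.Ioc (0 : ℝ) 2, (v : ℂ) ^ (p - 1) * (v : ℂ) ^ m =
          ∫ v in (0 : ℝ)..2, (v : ℂ) ^ (p + m - 1) := by
        rw [intervalIntegral.integral_of_le two_pos.le]
        refine setIntegral_congr_fun measurableSet_Ioc fun v hv => ?_
        have : (v : ℂ) ≠ 0 := by exact_mod_cast hv.1.ne'
        rw [← Complex.cpow_natCast, ← Complex.cpow_add _ _ this]
        ring_nf
      rw [h4, integral_cpow (Or.inl (by simp; positivity))]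
      have h5 : p + m ≠ 0 := by
        intro h
        have := congrArg Complex.re h
        simp at this
        have : (0 : ℝ) ≤ m := m.cast_nonneg
        linarith
      simp [Complex.zero_cpow h5]
    simp only [h3] at h2
    rw [h2.tsum_eq]
    rw [← Set.Ioc_union_Ioi_eq_Ioi (two_pos (α := ℝ)).le,
      setIntegral_union (Set.Ioc_disjoint_Ioi le_rfl) measurableSet_Ioi] at h1
    · rw [one_div, Complex.inv_cpow _ _ (by
        rw [Complex.arg_ofReal_of_nonneg hs.le]; exact Real.pi_pos.ne), ← Complex.cpow_neg] at h1
      rw [← h1]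
      ring
    · exact hI2
    · exact integrableOn_cpow_mul_exp_Ioi_two _ hs
  | succ j ih =>
    have hp' : ∀ n : ℤ, p + 1 ≠ n := fun n h => hp (n - 1) (by push_cast; linear_combination h)
    have hp0 : p ≠ 0 := by simpa using hp 0
    have h1 := ih hp' (by simp at hj ⊢; linarith)
    have hint1 := integrableOn_cpow_mul_exp_Ioi_two (p - 1) hs
    have hint2 := integrableOn_cpow_mul_exp_Ioi_two p hs
    have hder : ∀ v : ℝ, 0 < v → HasDerivAt
        (fun v : ℝ => (v : ℂ) ^ p * Complex.exp (-(s * v)))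
        (p * ((v : ℂ) ^ (p - 1) * Complex.exp (-(s * v))) -
          s * ((v : ℂ) ^ p * Complex.exp (-(s * v)))) v := by
      intro v hv
      have hv0 : v ≠ 0 := hv.ne'
      have e1 := hasDerivAt_ofReal_cpow_const' (r := p - 1) hv0 (by simpa using hp0)
      simp only [sub_add_cancel] at e1
      have e1' := e1.mul_const p
      simp only [div_mul_cancel₀ _ hp0] at e1'
      have e2 : HasDerivAt (fun v : ℝ => Complex.exp (-(s * v)))
          (Complex.exp (-(s * v)) * -(s * 1)) v :=
        (((hasDerivAt_id (v : ℂ)).const_mul (s : ℂ)).neg.cexp).comp_ofReal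
      refine (e1'.mul e2).congr_deriv ?_
      ring
    have hlim : Tendsto (fun v : ℝ => (v : ℂ) ^ p * Complex.exp (-(s * v))) atTop (𝓝 0) := by
      rw [tendsto_zero_iff_norm_tendsto_zero]
      refine (tendsto_rpow_mul_exp_neg_mul_atTop_nhds_zero p.re s hs).congr' ?_
      filter_upwards [eventually_gt_atTop 0] with v hv
      rw [norm_mul, Complex.norm_cpow_eq_rpow_re_of_pos hv, Complex.norm_exp]
      simp
    have h2 := integral_Ioi_of_hasDerivAt_of_tendsto
      (hder 2 two_pos).continuousAt.continuousWithinAt (fun v hv => hder v (lt_trans two_pos hv))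
      ((hint1.const_mul p).sub (hint2.const_mul (s : ℂ))) hlim
    rw [integral_sub (hint1.const_mul p) (hint2.const_mul (s : ℂ)), integral_const_mul,
      integral_const_mul] at h2
    rw [add_sub_cancel_right] at h1
    rw [h1, Complex.Gamma_add_one _ hp0, neg_add, Complex.cpow_add _ _ hs0, Complex.cpow_neg_one]
      at h2
    have hE : HasSum (fun m : ℕ => (-(s : ℂ)) ^ m / m.factorial * (2 : ℂ) ^ (p + m))
        ((2 : ℂ) ^ p * Complex.exp (-(s * 2))) := by
      have := (NormedSpace.expSeries_div_hasSum_exp (-(s : ℂ) * 2)).mul_left ((2 : ℂ) ^ p)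
      rw [← Complex.exp_eq_exp_ℂ, neg_mul] at this
      refine hasSum_of_forall_eq this fun m => ?_
      rw [Complex.cpow_add _ _ two_ne_zero, Complex.cpow_natCast, ← neg_mul, mul_pow]
      ring
    -- Since p/(p + m) - 1 = -m/(p + m), the term m = 0 of this difference vanishes, and shifting m
    -- by one leaves s times the series for p + 1.
    have hT := (((summable_lowerGamma hp s).hasSum.mul_left p).sub hE)
    rw [← hasSum_nat_add_iff' 1] at hT
    have hT1 := (summable_lowerGamma hp' s).hasSum.mul_left (s : ℂ)
    have e := hT.unique (hasSum_of_forall_eq hT1 fun m => by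
      have hm : p + 1 + m ≠ 0 := by
        have := hp' (-m)
        push_cast at this
        exact fun h => this (eq_neg_of_add_eq_zero_left h)
      have hf : ((m.factorial : ℕ) : ℂ) ≠ 0 := by exact_mod_cast m.factorial_ne_zero
      have hm1 : (m : ℂ) + 1 ≠ 0 := by exact_mod_cast m.succ_ne_zero
      rw [show p + ((m + 1 : ℕ) : ℂ) = p + 1 + m by push_cast; ring, Nat.factorial_succ]
      push_cast
      field_simp
      ring)
    simp [mul_div_cancel₀ _ hp0] at e
    apply mul_left_cancel₀ hp0
    simp only [Complex.ofReal_ofNat] at h2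
    have e3 : (s : ℂ) * (s : ℂ)⁻¹ = 1 := mul_inv_cancel₀ hs0
    linear_combination h2 + e + p * (s : ℂ) ^ (-p) * Complex.Gamma p * e3

/-! ### Binomial expansion under the integral sign -/

theorem norm_one_sub_cpow_le (μ : ℂ) {x : ℂ} (hx : ‖x‖ ≤ 1 / 2) :
    ‖(1 - x) ^ μ‖ ≤ ∑' k, ‖altBinom μ k‖ * (1 / 2 : ℝ) ^ k := by
  rw [← (hasSum_altBinom μ (lt_of_le_of_lt hx (by norm_num))).tsum_eq]
  refine tsum_of_norm_bounded
    (summable_norm_altBinom μ (by norm_num) (by norm_num : (1 / 2 : ℝ) < 1)).hasSum fun k => ?_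
  rw [norm_mul, norm_pow]
  gcongr

theorem integrableOn_mul_one_sub_cpow {S : Set ℝ} (hS : MeasurableSet S) {f : ℝ → ℂ}
    (hf : IntegrableOn f S) {g : ℝ → ℝ} (hg : Measurable g) (hgS : ∀ v ∈ S, |g v| ≤ 1 / 2) (μ : ℂ) :
    IntegrableOn (fun v => f v * (1 - (g v : ℂ)) ^ μ) S := by
  refine Integrable.mul_bdd (c := ∑' k, ‖altBinom μ k‖ * (1 / 2 : ℝ) ^ k) hf
    ((measurable_const.sub (Complex.measurable_ofReal.comp hg)).pow_const μ).aestronglyMeasurable ?_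
  filter_upwards [ae_restrict_mem hS] with v hv
  exact norm_one_sub_cpow_le μ (by simpa using hgS v hv)

theorem hasSum_integral_mul_one_sub_cpow {S : Set ℝ} (hS : MeasurableSet S) {f : ℝ → ℂ}
    (hf : IntegrableOn f S) {g : ℝ → ℝ} (hg : Measurable g) (hgS : ∀ v ∈ S, |g v| ≤ 1 / 2) (μ : ℂ) :
    HasSum (fun k => altBinom μ k * ∫ v in S, f v * (g v : ℂ) ^ k)
      (∫ v in S, f v * (1 - (g v : ℂ)) ^ μ) := by
  have hb := summable_norm_altBinom μ (by norm_num) (by norm_num : (1 / 2 : ℝ) < 1)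
  have key : HasSum (fun k => ∫ v in S, f v * (altBinom μ k * (g v : ℂ) ^ k))
      (∫ v in S, f v * (1 - (g v : ℂ)) ^ μ) := by
    refine hasSum_integral_of_dominated_convergence
      (fun k v => ‖f v‖ * (‖altBinom μ k‖ * (1 / 2 : ℝ) ^ k)) (fun m => ?_) (fun m => ?_) ?_ ?_ ?_
    · exact hf.aestronglyMeasurable.mul (by fun_prop)
    · filter_upwards [ae_restrict_mem hS] with v hv
      rw [norm_mul, norm_mul, norm_pow, Complex.norm_real, Real.norm_eq_abs]
      have := hgS v hv
      gcongr
    · exact ae_of_all _ fun v => hb.mul_left _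
    · simp_rw [tsum_mul_left]
      exact hf.norm.mul_const _
    · filter_upwards [ae_restrict_mem hS] with v hv
      refine (hasSum_altBinom μ ?_).mul_left _
      have := hgS v hv
      rw [Complex.norm_real, Real.norm_eq_abs]
      linarith
  refine hasSum_of_forall_eq key fun m => ?_
  rw [← integral_const_mul]
  refine integral_congr_ae (ae_of_all _ fun v => ?_)
  simp only
  ring

theorem norm_two_cpow_sub_div_le {κ : ℂ} {δ : ℝ} (hδ : 0 < δ) (h : ∀ n : ℤ, δ ≤ ‖κ + n‖) (k : ℕ) :
    ‖(2 : ℂ) ^ (κ - k) / (κ - k)‖ ≤ ‖(2 : ℂ) ^ κ‖ / δ * (1 / 2) ^ k := by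
  have hk := h (-k)
  push_cast at hk
  rw [← sub_eq_add_neg] at hk
  rw [Complex.cpow_sub _ _ two_ne_zero, Complex.cpow_natCast]
  simp only [norm_div, norm_pow, Complex.norm_ofNat]
  calc ‖(2 : ℂ) ^ κ‖ / 2 ^ k / ‖κ - k‖ ≤ ‖(2 : ℂ) ^ κ‖ / 2 ^ k / δ := by gcongr
    _ = _ := by rw [one_div, inv_pow]; ring

theorem summable_altBinom_mul_two_cpow (μ : ℂ) {κ : ℂ} (hκ : ∀ n : ℤ, κ ≠ n) :
    Summable fun k : ℕ => altBinom μ k * ((2 : ℂ) ^ (κ - k) / (κ - k)) := by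
  obtain ⟨δ, hδ, h⟩ := exists_le_norm_add_int hκ
  refine Summable.of_norm_bounded ((summable_norm_altBinom μ (by norm_num)
    (by norm_num : (1 / 2 : ℝ) < 1)).mul_left (‖(2 : ℂ) ^ κ‖ / δ)) fun k => ?_
  rw [norm_mul]
  calc ‖altBinom μ k‖ * ‖(2 : ℂ) ^ (κ - k) / (κ - k)‖
      ≤ ‖altBinom μ k‖ * (‖(2 : ℂ) ^ κ‖ / δ * (1 / 2) ^ k) := by
        gcongr; exact norm_two_cpow_sub_div_le hδ h k
    _ = _ := by ring

/-! ### The finite-part beta integral over (1, ∞) -/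

/-- The regularised integral `∫ v ^ c (v - 1) ^ μ` over `(1, ∞)`. -/
def regBeta (μ c : ℂ) : ℂ :=
  (∫ v in Set.Ioc (1 : ℝ) 2, (v : ℂ) ^ c * ((v : ℂ) - 1) ^ μ) -
    ∑' k : ℕ, altBinom μ k * ((2 : ℂ) ^ (c + μ + 1 - k) / (c + μ + 1 - k))

theorem integrableOn_Ioc_one_two {μ : ℂ} (hμ : -1 < μ.re) (c : ℂ) :
    IntegrableOn (fun v : ℝ => (v : ℂ) ^ c * ((v : ℂ) - 1) ^ μ) (Set.Ioc 1 2) := by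
  have h1 : IntervalIntegrable (fun v : ℝ => ((v - 1 : ℝ) : ℂ) ^ μ) volume 1 2 := by
    have := (intervalIntegral.intervalIntegrable_cpow' (a := 0) (b := 1) hμ).comp_sub_right 1
    norm_num at this
    simpa using this
  rw [intervalIntegrable_iff_integrableOn_Ioc_of_le one_le_two] at h1
  refine (h1.continuousOn_mul_of_subset (K := Set.Icc 1 2) (g := fun v : ℝ => (v : ℂ) ^ c)
    (fun v hv => ?_) isCompact_Icc measurableSet_Ioc Set.Ioc_subset_Icc_self).congr_fun
    (fun v _ => by simp) measurableSet_Ioc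
  exact (Complex.continuousAt_ofReal_cpow_const v c
    (Or.inr (lt_of_lt_of_le one_pos hv.1).ne')).continuousWithinAt

/-- The left side integrates the derivative of v^{c+1}(v - 1)^{μ+1}. Because Re μ > -1 the boundary
value at 1 is zero, and the one at 2 is 2^{c+1}. -/
theorem integral_Ioc_one_two_succ {μ : ℂ} (hμ : -1 < μ.re) (c : ℂ) :
    (c + μ + 2) * (∫ v in Set.Ioc (1 : ℝ) 2, (v : ℂ) ^ (c + 1) * ((v : ℂ) - 1) ^ μ) -
      (c + 1) * (∫ v in Set.Ioc (1 : ℝ) 2, (v : ℂ) ^ c * ((v : ℂ) - 1) ^ μ) =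
      (2 : ℂ) ^ (c + 1) := by
  have i0 := integrableOn_Ioc_one_two hμ c
  have i1 := integrableOn_Ioc_one_two hμ (c + 1)
  have hμ0 : μ + 1 ≠ 0 := fun h => by
    have := congrArg Complex.re h
    simp at this
    linarith
  have hcont : ContinuousOn (fun v : ℝ => (v : ℂ) ^ (c + 1) * ((v : ℂ) - 1) ^ (μ + 1))
      (Set.Icc 1 2) := by
    refine ContinuousOn.mul (fun v hv => ?_) (Continuous.continuousOn ?_)
    · exact (Complex.continuousAt_ofReal_cpow_const v _
        (Or.inr (lt_of_lt_of_le one_pos hv.1).ne')).continuousWithinAt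
    · have := (Complex.continuous_ofReal_cpow_const (y := μ + 1) (by simp; linarith)).comp
        (continuous_id.sub (continuous_const (y := (1 : ℝ))))
      simpa [Function.comp_def] using this
  have hder : ∀ v ∈ Set.Ioo (1 : ℝ) 2, HasDerivAt
      (fun v : ℝ => (v : ℂ) ^ (c + 1) * ((v : ℂ) - 1) ^ (μ + 1))
      ((c + μ + 2) * ((v : ℂ) ^ (c + 1) * ((v : ℂ) - 1) ^ μ) -
        (c + 1) * ((v : ℂ) ^ c * ((v : ℂ) - 1) ^ μ)) v := by
    intro v hv
    have hv0 : 0 < v := one_pos.trans hv.1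
    have hv1 : (0 : ℝ) < v - 1 := sub_pos.2 hv.1
    have hvc : (v : ℂ) ≠ 0 := by exact_mod_cast hv0.ne'
    have hvc1 : (v : ℂ) - 1 ≠ 0 := by exact_mod_cast hv1.ne'
    have d1 := ((hasDerivAt_id (v : ℂ)).cpow_const (c := c + 1)
      (Complex.ofReal_mem_slitPlane.2 hv0)).comp_ofReal
    have d2 := (((hasDerivAt_id (v : ℂ)).sub_const 1).cpow_const (c := μ + 1)
      (by simpa using Complex.ofReal_mem_slitPlane.2 hv1)).comp_ofReal
    refine (d1.mul d2).congr_deriv ?_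
    simp only [id, add_sub_cancel_right, mul_one]
    rw [Complex.cpow_add _ _ hvc, Complex.cpow_add _ _ hvc1]
    simp only [Complex.cpow_one]
    ring
  have h := intervalIntegral.integral_eq_sub_of_hasDerivAt_of_le one_le_two hcont hder
    ((intervalIntegrable_iff_integrableOn_Ioc_of_le one_le_two).2
      ((i1.const_mul _).sub (i0.const_mul _)))
  rw [intervalIntegral.integral_of_le one_le_two,
    integral_sub (i1.const_mul _) (i0.const_mul _), integral_const_mul, integral_const_mul] at h
  rw [h]
  norm_num
  exact hμ0

/-- The series stands for minus the formal tail integral over (2, ∞). Its recursion has the boundary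
term 2^{c+1} = 2^{c+μ+1}(1 - 1/2)^μ, the same as for the integral over (1, 2], so that the two
cancel in `regBeta_succ`. -/
theorem tsum_altBinom_mul_two_cpow_succ (μ c : ℂ) (hκ : ∀ n : ℤ, c + μ + 1 ≠ n) :
    (c + μ + 2) * (∑' k : ℕ, altBinom μ k *
        ((2 : ℂ) ^ (c + 1 + μ + 1 - k) / (c + 1 + μ + 1 - k))) -
      (c + 1) * (∑' k : ℕ, altBinom μ k * ((2 : ℂ) ^ (c + μ + 1 - k) / (c + μ + 1 - k))) =
      (2 : ℂ) ^ (c + 1) := by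
  have hκ1 : ∀ n : ℤ, c + 1 + μ + 1 ≠ n := fun n h => hκ (n - 1) (by
    push_cast; linear_combination h)
  have s0 := (summable_altBinom_mul_two_cpow μ hκ).hasSum
  have s1 := (summable_altBinom_mul_two_cpow μ hκ1).hasSum
  have hh : HasSum (fun k : ℕ => altBinom μ k * (2 : ℂ) ^ (c + μ + 1 - k)) ((2 : ℂ) ^ (c + 1)) := by
    have h := (hasSum_altBinom μ (x := 1 / 2) (by norm_num)).mul_left ((2 : ℂ) ^ (c + μ + 1))
    have e : (2 : ℂ) ^ (c + μ + 1) * (1 - 1 / 2) ^ μ = (2 : ℂ) ^ (c + 1) := by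
      have e1 : (1 - 1 / 2 : ℂ) ^ μ = (2 : ℂ) ^ (-μ) := by
        rw [show (1 - 1 / 2 : ℂ) = 2⁻¹ by norm_num, Complex.inv_cpow _ _ (by
          rw [← Complex.ofReal_ofNat, Complex.arg_ofReal_of_nonneg two_pos.le]
          exact Real.pi_pos.ne), Complex.cpow_neg]
      rw [e1, ← Complex.cpow_add _ _ two_ne_zero]
      ring_nf
    rw [e] at h
    refine hasSum_of_forall_eq h fun k => ?_
    rw [Complex.cpow_sub _ _ two_ne_zero, Complex.cpow_natCast, one_div, inv_pow]
    ring
  -- `(κ + 1) / (κ + 1 - k) = 1 + k / (κ + 1 - k)` in the first series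
  have hA := (s1.mul_left (c + μ + 2)).sub (hh.mul_left 2)
  rw [← hasSum_nat_add_iff' 1] at hA
  have hB := (s0.mul_left (c + 1)).sub hh
  have e := hA.unique (hasSum_of_forall_eq hB fun k => by
    have hk : c + μ + 1 - k ≠ 0 := fun h => hκ k (by push_cast; linear_combination h)
    have hr := altBinom_succ μ k
    have hk1 : (k : ℂ) + 1 ≠ 0 := by exact_mod_cast k.succ_ne_zero
    rw [show c + 1 + μ + 1 - ((k + 1 : ℕ) : ℂ) = c + μ + 1 - k by push_cast; ring,
      show c + μ + 1 - ((k + 1 : ℕ) : ℂ) = c + μ + 1 - k - 1 by push_cast; ring,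
      Complex.cpow_sub _ 1 two_ne_zero, Complex.cpow_one]
    have e1 : (c + μ + 2) / (c + μ + 1 - k) = 1 + (k + 1) / (c + μ + 1 - k) := by
      field_simp
      ring
    have e2 : (c + 1) / (c + μ + 1 - k) = 1 + (k - μ) / (c + μ + 1 - k) := by
      field_simp
      ring
    linear_combination (altBinom μ (k + 1) * (2 : ℂ) ^ (c + μ + 1 - k)) * e1 -
      (altBinom μ k * (2 : ℂ) ^ (c + μ + 1 - k)) * e2 +
      (2 : ℂ) ^ (c + μ + 1 - k) / (c + μ + 1 - k) * hr)
  have h2 : c + μ + 2 ≠ 0 := by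
    have := hκ1 0
    intro h
    apply this
    push_cast
    linear_combination h
  have e3 : (c + μ + 2) * ((2 : ℂ) ^ (c + μ + 2) / (c + μ + 2)) = (2 : ℂ) ^ (c + μ + 2) :=
    mul_div_cancel₀ _ h2
  have e4 : (2 : ℂ) ^ (c + μ + 2) = 2 * (2 : ℂ) ^ (c + μ + 1) := by
    rw [show c + μ + 2 = c + μ + 1 + 1 by ring, Complex.cpow_add _ _ two_ne_zero, Complex.cpow_one]
    ring
  simp only [Finset.range_one, Finset.sum_singleton, altBinom_zero, Nat.cast_zero, sub_zero,
    one_mul, show c + 1 + μ + 1 = c + μ + 2 by ring] at e ⊢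
  linear_combination e + e3 + e4

theorem regBeta_succ {μ : ℂ} (hμ : -1 < μ.re) (c : ℂ) (hκ : ∀ n : ℤ, c + μ + 1 ≠ n) :
    (c + μ + 2) * regBeta μ (c + 1) = (c + 1) * regBeta μ c := by
  have h1 := integral_Ioc_one_two_succ hμ c
  have h2 := tsum_altBinom_mul_two_cpow_succ μ c hκ
  simp only [regBeta]
  linear_combination h1 - h2

/-- The substitution u = 1/v, which produces part of the integral B(-(c+μ+1), μ+1). -/
theorem integral_Ioc_one_two_eq (μ c : ℂ) (hμ : -1 < μ.re) (hκ : (c + μ + 1).re < 0) :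
    ∫ v in Set.Ioc (1 : ℝ) 2, (v : ℂ) ^ c * ((v : ℂ) - 1) ^ μ =
      ∫ u in (1 / 2 : ℝ)..1, (u : ℂ) ^ (-(c + μ + 1) - 1) * (1 - (u : ℂ)) ^ (μ + 1 - 1) := by
  have hbeta := Complex.betaIntegral_convergent (u := -(c + μ + 1)) (v := μ + 1)
    (by simp at hκ ⊢; linarith) (by simp; linarith)
  have hcongr : ∀ v : ℝ, 1 < v → ((v⁻¹ : ℝ) : ℂ) ^ (-(c + μ + 1) - 1) *
      (1 - ((v⁻¹ : ℝ) : ℂ)) ^ (μ + 1 - 1) * (-((v : ℂ) ^ 2)⁻¹) =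
      -((v : ℂ) ^ c * ((v : ℂ) - 1) ^ μ) := by
    intro v hv
    have hv0 : 0 < v := one_pos.trans hv
    have hvc : (v : ℂ) ≠ 0 := by exact_mod_cast hv0.ne'
    have e1 : (1 - ((v⁻¹ : ℝ) : ℂ)) = ((v⁻¹ : ℝ) : ℂ) * ((v - 1 : ℝ) : ℂ) := by
      push_cast
      field_simp
    rw [e1, Complex.mul_cpow_ofReal_nonneg (inv_pos.2 hv0).le (sub_pos.2 hv).le,
      add_sub_cancel_right, Complex.ofReal_inv, Complex.inv_cpow _ _ (by
        rw [Complex.arg_ofReal_of_nonneg hv0.le]; exact Real.pi_pos.ne), Complex.inv_cpow _ _ (by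
        rw [Complex.arg_ofReal_of_nonneg hv0.le]; exact Real.pi_pos.ne), ← Complex.cpow_neg,
      ← Complex.cpow_neg, ← Complex.cpow_natCast, ← Complex.cpow_neg]
    rw [show (v : ℂ) ^ c = (v : ℂ) ^ (-(-(c + μ + 1) - 1)) * (v : ℂ) ^ (-μ) *
      (v : ℂ) ^ (-((2 : ℕ) : ℂ)) by
      rw [← Complex.cpow_add _ _ hvc, ← Complex.cpow_add _ _ hvc]
      congr 1
      push_cast
      ring]
    push_cast
    ring
  have hf : ContinuousOn (fun v : ℝ => v⁻¹) (Set.uIcc 1 2) := fun v hv => by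
    rw [Set.uIcc_of_le one_le_two] at hv
    exact (continuousAt_inv₀ (lt_of_lt_of_le one_pos hv.1).ne').continuousWithinAt
  have hmin : min (1 : ℝ) 2 = 1 := min_eq_left one_le_two
  have hmax : max (1 : ℝ) 2 = 2 := max_eq_right one_le_two
  have h := intervalIntegral.integral_deriv_smul_comp''' (a := 1) (b := 2)
    (f := fun v : ℝ => v⁻¹) (f' := fun v => -(v ^ 2)⁻¹)
    (g := fun u : ℝ => (u : ℂ) ^ (-(c + μ + 1) - 1) * (1 - (u : ℂ)) ^ (μ + 1 - 1)) hf ?_ ?_ ?_ ?_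
  · rw [intervalIntegral.integral_symm, one_div]
    simp only [inv_one] at h
    rw [← h, intervalIntegral.integral_of_le one_le_two, ← integral_neg]
    refine setIntegral_congr_fun measurableSet_Ioc fun v hv => ?_
    have := hcongr v hv.1
    simp only [Function.comp, Complex.real_smul]
    push_cast at this ⊢
    linear_combination this
  · rw [hmin, hmax]
    intro v hv
    exact (hasDerivAt_inv (one_pos.trans hv.1).ne').hasDerivWithinAt
  · rw [hmin, hmax]
    rintro _ ⟨v, hv, rfl⟩
    have hv0 : (0 : ℝ) < v⁻¹ := inv_pos.2 (one_pos.trans hv.1)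
    have hv1 : (0 : ℝ) < 1 - v⁻¹ := sub_pos.2 (inv_lt_one_of_one_lt₀ hv.1)
    refine ContinuousAt.continuousWithinAt (ContinuousAt.mul
      (Complex.continuousAt_ofReal_cpow_const _ _ (Or.inr hv0.ne')) ?_)
    exact ContinuousAt.cpow (by fun_prop) continuousAt_const
      (by simpa using Complex.ofReal_mem_slitPlane.2 hv1)
  · rw [intervalIntegrable_iff', Set.uIcc_of_le zero_le_one] at hbeta
    refine hbeta.mono_set ?_
    rw [Set.uIcc_of_le one_le_two]
    rintro _ ⟨v, hv, rfl⟩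
    exact ⟨inv_nonneg.2 (zero_le_one.trans hv.1), inv_le_one_of_one_le₀ hv.1⟩
  · rw [Set.uIcc_of_le one_le_two, integrableOn_Icc_iff_integrableOn_Ioc]
    refine (integrableOn_Ioc_one_two hμ c).neg.congr_fun (fun v hv => ?_) measurableSet_Ioc
    have := hcongr v hv.1
    simp only [Function.comp, Complex.real_smul, Pi.neg_apply]
    push_cast at this ⊢
    linear_combination -this

/-- In this range the tail integral converges. The substitution u = 1/v maps it to (0, 1/2), where
the binomial series integrates termwise to minus the series in `regBeta`. The two pieces add up to
B(-(c+μ+1), μ+1). -/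
theorem regBeta_eq_of_re_neg {μ c : ℂ} (hμ : -1 < μ.re) (hκ : (c + μ + 1).re < 0)
    (hκ' : ∀ n : ℤ, c + μ + 1 ≠ n) :
    regBeta μ c = Complex.Gamma (-(c + μ + 1)) * Complex.Gamma (μ + 1) / Complex.Gamma (-c) := by
  have hre : 0 < (-(c + μ + 1)).re := by simp at hκ ⊢; linarith
  have hre1 : 0 < (μ + 1).re := by simp; linarith
  have hbeta := Complex.betaIntegral_convergent hre hre1
  have hI1 := hbeta.mono_set (c := 0) (d := 1 / 2) (Set.uIcc_subset_uIcc (by simp) (by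
    simp; norm_num))
  have hI2 := hbeta.mono_set (c := 1 / 2) (d := 1) (Set.uIcc_subset_uIcc (by
    simp; norm_num) (by simp))
  have hsplit := intervalIntegral.integral_add_adjacent_intervals hI1 hI2
  have hhalf : ∫ u in (0 : ℝ)..1 / 2,
      (u : ℂ) ^ (-(c + μ + 1) - 1) * (1 - (u : ℂ)) ^ (μ + 1 - 1) =
      -∑' k : ℕ, altBinom μ k * ((2 : ℂ) ^ (c + μ + 1 - k) / (c + μ + 1 - k)) := by
    rw [intervalIntegral.integral_of_le (by norm_num), add_sub_cancel_right]
    have hf : IntegrableOn (fun u : ℝ => (u : ℂ) ^ (-(c + μ + 1) - 1)) (Set.Ioc 0 (1 / 2)) :=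
      (intervalIntegrable_iff_integrableOn_Ioc_of_le (by norm_num)).1
        (intervalIntegral.intervalIntegrable_cpow' (by simp at hre ⊢; linarith))
    have h := hasSum_integral_mul_one_sub_cpow measurableSet_Ioc hf measurable_id
      (fun v hv => abs_le.2 ⟨by simp; linarith [hv.1], hv.2⟩) μ
    simp only [id] at h
    rw [← h.tsum_eq, ← tsum_neg]
    refine tsum_congr fun k => ?_
    have e1 : ∫ v in Set.Ioc (0 : ℝ) (1 / 2), (v : ℂ) ^ (-(c + μ + 1) - 1) * (v : ℂ) ^ k =
        ∫ v in (0 : ℝ)..(1 / 2), (v : ℂ) ^ (-(c + μ + 1 - k) - 1) := by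
      rw [intervalIntegral.integral_of_le (by norm_num)]
      refine setIntegral_congr_fun measurableSet_Ioc fun v hv => ?_
      have : (v : ℂ) ≠ 0 := by exact_mod_cast hv.1.ne'
      rw [← Complex.cpow_natCast, ← Complex.cpow_add _ _ this]
      ring_nf
    have hk : c + μ + 1 - k ≠ 0 := fun h => hκ' k (by push_cast; linear_combination h)
    rw [e1, integral_cpow (Or.inl (by
      have : (0 : ℝ) ≤ k := k.cast_nonneg
      simp at hre ⊢; linarith)), sub_add_cancel, Complex.ofReal_zero,
      Complex.zero_cpow (neg_ne_zero.2 hk), sub_zero, Complex.ofReal_div, Complex.ofReal_one,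
      one_div, Complex.inv_cpow _ _ (by
        rw [Complex.arg_ofReal_of_nonneg two_pos.le]; exact Real.pi_pos.ne), Complex.cpow_neg,
      inv_inv, Complex.ofReal_ofNat]
    rw [div_neg]
    ring
  have hΓ : Complex.Gamma (-c) ≠ 0 := Complex.Gamma_ne_zero_of_re_pos (by
    simp at hre hre1 ⊢; linarith)
  rw [regBeta, integral_Ioc_one_two_eq μ c hμ hκ, eq_div_iff hΓ,
    Complex.Gamma_mul_Gamma_eq_betaIntegral hre hre1, Complex.betaIntegral, ← hsplit, hhalf]
  ring_nf

theorem regBeta_eq {μ c : ℂ} (hμ : -1 < μ.re) (hκ : ∀ n : ℤ, c + μ + 1 ≠ n) :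
    regBeta μ c = Complex.Gamma (-(c + μ + 1)) * Complex.Gamma (μ + 1) / Complex.Gamma (-c) := by
  -- The contiguous relation carries the convergent case upwards in Re c, one unit at a time.
  obtain ⟨j, hj⟩ := exists_nat_gt (c + μ + 1).re
  induction j generalizing c with
  | zero => exact regBeta_eq_of_re_neg hμ (by exact_mod_cast hj) hκ
  | succ j ih =>
    have hκ1 : ∀ n : ℤ, c - 1 + μ + 1 ≠ n := fun n h => hκ (n + 1) (by
      push_cast; linear_combination h)
    have hκ0 : c + μ + 1 ≠ 0 := by simpa using hκ 0
    have h1 := ih hκ1 (by simp at hj ⊢; linarith)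
    have h2 := regBeta_succ hμ (c - 1) hκ1
    rw [h1, sub_add_cancel, show c - 1 + μ + 2 = c + μ + 1 by ring,
      show -(c - 1 + μ + 1) = -(c + μ + 1) + 1 by ring, show -(c - 1) = -c + 1 by ring,
      Complex.Gamma_add_one _ (neg_ne_zero.2 hκ0)] at h2
    apply mul_left_cancel₀ hκ0
    rw [h2]
    -- At c = 0 the recursion gives 0. The right side is also 0, through the conventions Γ(0) = 0
    -- and x/0 = 0, which agree with the zero of 1/Γ.
    by_cases hc : c = 0
    · simp [hc, Complex.Gamma_zero]
    · rw [Complex.Gamma_add_one _ (neg_ne_zero.2 hc)]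
      field_simp

/-! ### The analytic part of the moments -/

/-- Γ(κ - k) is Γ(κ) divided by (κ - 1)⋯(κ - k), and each factor has modulus at least δ. This crude
geometric bound already gives a positive radius of convergence. -/
theorem norm_Gamma_sub_nat_le {κ : ℂ} {δ : ℝ} (hδ : 0 < δ) (h : ∀ n : ℤ, δ ≤ ‖κ + n‖) (k : ℕ) :
    ‖Complex.Gamma (κ - k)‖ ≤ ‖Complex.Gamma κ‖ * (1 / δ) ^ k := by
  induction k with
  | zero => simp
  | succ k ih =>
    have hk := h (-(k + 1 : ℕ))
    push_cast at hk
    rw [← sub_eq_add_neg] at hk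
    have h0 : κ - (k + 1 : ℂ) ≠ 0 := norm_pos_iff.1 (hδ.trans_le hk)
    have e := Complex.Gamma_add_one _ h0
    rw [show κ - (k + 1 : ℂ) + 1 = κ - k by ring] at e
    rw [e, norm_mul] at ih
    push_cast
    rw [pow_succ, ← mul_assoc, mul_one_div, le_div_iff₀ hδ]
    refine le_trans ?_ ih
    rw [mul_comm]
    gcongr

theorem summable_momentA (μ : ℂ) {κ : ℂ} {δ : ℝ} (hδ : 0 < δ) (h : ∀ n : ℤ, δ ≤ ‖κ + n‖) :
    Summable fun k : ℕ => ‖altBinom μ k * Complex.Gamma (κ - k)‖ * (δ / 2) ^ k := by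
  refine Summable.of_nonneg_of_le (fun k => by positivity) (fun k => ?_)
    ((summable_norm_altBinom μ (by norm_num)
      (by norm_num : (1 / 2 : ℝ) < 1)).mul_left ‖Complex.Gamma κ‖)
  rw [norm_mul]
  calc ‖altBinom μ k‖ * ‖Complex.Gamma (κ - k)‖ * (δ / 2) ^ k
      ≤ ‖altBinom μ k‖ * (‖Complex.Gamma κ‖ * (1 / δ) ^ k) * (δ / 2) ^ k := by
        gcongr
        exact norm_Gamma_sub_nat_le hδ h k
    _ = ‖Complex.Gamma κ‖ * (‖altBinom μ k‖ * (1 / δ * (δ / 2)) ^ k) := by rw [mul_pow]; ring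
    _ = _ := by
        congr 3
        field_simp

/-- The analytic part of the moments of `x ^ (κ - μ - 1) (x - s) ^ μ e ^ (-x)`. -/
def momentA (μ κ z : ℂ) : ℂ := ∑' k : ℕ, altBinom μ k * Complex.Gamma (κ - k) * z ^ k

theorem analyticAt_momentA (μ : ℂ) {κ : ℂ} (hκ : ∀ n : ℤ, κ ≠ n) :
    AnalyticAt ℂ (momentA μ κ) 0 := by
  obtain ⟨δ, hδ, h⟩ := exists_le_norm_add_int hκ
  exact (hasFPowerSeriesAt_tsum_pow (half_pos hδ) (summable_momentA μ hδ h)).analyticAt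

theorem hasDerivAt_momentA (μ : ℂ) {κ : ℂ} (hκ : ∀ n : ℤ, κ ≠ n) :
    HasDerivAt (momentA μ κ) (-μ * Complex.Gamma (κ - 1)) 0 := by
  obtain ⟨δ, hδ, h⟩ := exists_le_norm_add_int hκ
  have := hasDerivAt_tsum_pow (half_pos hδ) (summable_momentA μ hδ h)
  rw [altBinom_one, Nat.cast_one] at this
  exact this

theorem momentA_zero (μ κ : ℂ) : momentA μ κ 0 = Complex.Gamma κ := by
  simp [momentA, tsum_pow_zero, altBinom_zero]

/-- Fubini for a double series, majorised by the product of Σ‖altBinom‖ 2^{-k} and an exponential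
series. Summing over k first recreates the tails in `regBeta`. -/
theorem hasSum_altBinom_lowerGamma (μ : ℂ) {κ : ℂ} (hκ : ∀ n : ℤ, κ ≠ n) (z : ℂ) :
    ∃ t, HasSum (fun k : ℕ => altBinom μ k *
        ∑' m : ℕ, (-z) ^ m / m.factorial * ((2 : ℂ) ^ (κ - k + m) / (κ - k + m))) t ∧
      HasSum (fun m : ℕ => (-z) ^ m / m.factorial *
        ∑' k : ℕ, altBinom μ k * ((2 : ℂ) ^ (κ + m - k) / (κ + m - k))) t := by
  obtain ⟨δ, hδ, h⟩ := exists_le_norm_add_int hκ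
  set F : ℕ × ℕ → ℂ := fun p => altBinom μ p.1 *
    ((-z) ^ p.2 / p.2.factorial * ((2 : ℂ) ^ (κ - p.1 + p.2) / (κ - p.1 + p.2))) with hF
  have hs : Summable F := by
    have h1 := (summable_norm_altBinom μ (by norm_num) (by norm_num : (1 / 2 : ℝ) < 1)).mul_of_nonneg
      (Real.summable_pow_div_factorial (‖z‖ * 2)) (fun k => by positivity) (fun m => by positivity)
    refine Summable.of_norm_bounded (h1.mul_left (‖(2 : ℂ) ^ κ‖ / δ)) fun p => ?_
    obtain ⟨k, m⟩ := p
    have hm := h (m - k : ℤ)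
    push_cast at hm
    rw [show κ + ((m : ℂ) - k) = κ - k + m by ring] at hm
    simp only [hF, norm_mul, norm_div, norm_pow, norm_neg, Complex.norm_natCast]
    rw [Complex.cpow_add _ _ two_ne_zero, Complex.cpow_natCast, Complex.cpow_sub _ _ two_ne_zero,
      Complex.cpow_natCast]
    simp only [norm_mul, norm_div, norm_pow, Complex.norm_ofNat]
    calc ‖altBinom μ k‖ * (‖z‖ ^ m / m.factorial *
          (‖(2 : ℂ) ^ κ‖ / 2 ^ k * 2 ^ m / ‖κ - k + m‖))
        ≤ ‖altBinom μ k‖ * (‖z‖ ^ m / m.factorial * (‖(2 : ℂ) ^ κ‖ / 2 ^ k * 2 ^ m / δ)) := by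
          gcongr
      _ = _ := by
          rw [mul_pow, one_div, inv_pow]
          ring
  refine ⟨∑' p, F p, ?_, ?_⟩
  · refine hs.hasSum.prod_fiberwise fun k => ?_
    exact ((summable_lowerGamma (p := κ - k) (fun n h => hκ (n + k) (by
      push_cast; linear_combination h)) z).hasSum).mul_left (altBinom μ k)
  · have hs' := (Equiv.prodComm ℕ ℕ).hasSum_iff.2 hs.hasSum
    refine hs'.prod_fiberwise fun m => ?_
    refine hasSum_of_forall_eq ((summable_altBinom_mul_two_cpow μ (κ := κ + m) (fun n h =>
      hκ (n - m) (by push_cast; linear_combination h))).hasSum.mul_left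
      ((-z) ^ m / m.factorial)) fun k => ?_
    simp only [hF, Function.comp, Prod.swap, Equiv.prodComm_apply,
      show κ - (k : ℂ) + m = κ + m - k by ring]
    ring

theorem Ioi_two_integrand_eq (μ c : ℂ) {v : ℝ} (hv : 2 < v) (s : ℝ) :
    (v : ℂ) ^ (c + μ + 1 - 1) * Complex.exp (-(s * v)) * (1 - ((v⁻¹ : ℝ) : ℂ)) ^ μ =
      (v : ℂ) ^ c * ((v : ℂ) - 1) ^ μ * Complex.exp (-(s * v)) := by
  have hv0 : 0 < v := two_pos.trans hv
  have hvc : (v : ℂ) ≠ 0 := by exact_mod_cast hv0.ne'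
  have hv1 : (0 : ℝ) ≤ 1 - v⁻¹ := sub_nonneg.2 (inv_le_one_of_one_le₀ (by linarith))
  have e : (v : ℂ) - 1 = (v : ℂ) * ((1 - v⁻¹ : ℝ) : ℂ) := by
    push_cast
    field_simp
  rw [e, Complex.mul_cpow_ofReal_nonneg hv0.le hv1, add_sub_cancel_right,
    Complex.cpow_add _ _ hvc]
  push_cast
  ring

theorem abs_inv_le_half {v : ℝ} (hv : v ∈ Set.Ioi (2 : ℝ)) : |v⁻¹| ≤ 1 / 2 := by
  rw [abs_of_pos (inv_pos.2 (two_pos.trans hv)), one_div]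
  exact inv_anti₀ two_pos (le_of_lt hv)

theorem integrableOn_Ioi_two (μ c : ℂ) {s : ℝ} (hs : 0 < s) :
    IntegrableOn (fun v : ℝ => (v : ℂ) ^ c * ((v : ℂ) - 1) ^ μ * Complex.exp (-(s * v)))
      (Set.Ioi 2) :=
  (integrableOn_mul_one_sub_cpow measurableSet_Ioi
    (integrableOn_cpow_mul_exp_Ioi_two (c + μ + 1 - 1) hs) measurable_inv
    (fun _ hv => abs_inv_le_half hv) μ).congr_fun
    (fun _ hv => Ioi_two_integrand_eq μ c hv s) measurableSet_Ioi

/-- Expand (1 - 1/v)^μ and integrate each power as an incomplete Gamma integral. The complete Gamma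
values sum to s^{-κ} `momentA`, and the lower parts, summed in the other order, are the tails that
`regBeta` subtracts at exponents c + m. -/
theorem hasSum_integral_Ioi_two (μ c : ℂ) {δ : ℝ} (hδ : 0 < δ)
    (h : ∀ n : ℤ, δ ≤ ‖c + μ + 1 + n‖) {s : ℝ} (hs : 0 < s) (hsδ : s ≤ δ / 2) :
    HasSum (fun m : ℕ => (-(s : ℂ)) ^ m / m.factorial *
        ∑' k : ℕ, altBinom μ k * ((2 : ℂ) ^ (c + μ + 1 + m - k) / (c + μ + 1 + m - k)))
      ((s : ℂ) ^ (-(c + μ + 1)) * momentA μ (c + μ + 1) s -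
        ∫ v in Set.Ioi (2 : ℝ), (v : ℂ) ^ c * ((v : ℂ) - 1) ^ μ * Complex.exp (-(s * v))) := by
  set κ := c + μ + 1 with hκdef
  have hs0 : (s : ℂ) ≠ 0 := by exact_mod_cast hs.ne'
  have hκ : ∀ n : ℤ, κ ≠ n := fun n hn => by
    have := h (-n)
    rw [hn] at this
    simp at this
    linarith
  obtain ⟨t, ht1, ht2⟩ := hasSum_altBinom_lowerGamma μ hκ (s : ℂ)
  have h1 := hasSum_integral_mul_one_sub_cpow measurableSet_Ioi
    (integrableOn_cpow_mul_exp_Ioi_two (κ - 1) hs) measurable_inv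
    (fun _ hv => abs_inv_le_half hv) μ
  rw [setIntegral_congr_fun measurableSet_Ioi
    (fun _ hv => Ioi_two_integrand_eq μ c hv s)] at h1
  have h2 : HasSum (fun k : ℕ => altBinom μ k * Complex.Gamma (κ - k) * (s : ℂ) ^ k)
      (momentA μ κ s) := by
    refine Summable.hasSum (Summable.of_norm_bounded (summable_momentA μ hδ h) fun k => ?_)
    rw [norm_mul, norm_pow, Complex.norm_real, Real.norm_of_nonneg hs.le]
    gcongr
  have h3 := (h2.mul_left ((s : ℂ) ^ (-κ))).sub h1
  have e := h3.unique (hasSum_of_forall_eq ht1 fun k => ?_)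
  · rw [e]
    exact ht2
  have e1 : ∫ v in Set.Ioi (2 : ℝ), (v : ℂ) ^ (κ - 1) * Complex.exp (-(s * v)) *
      ((v⁻¹ : ℝ) : ℂ) ^ k = ∫ v in Set.Ioi (2 : ℝ), (v : ℂ) ^ (κ - k - 1) *
        Complex.exp (-(s * v)) := by
    refine setIntegral_congr_fun measurableSet_Ioi fun v hv => ?_
    have hvc : (v : ℂ) ≠ 0 := by exact_mod_cast (two_pos.trans hv).ne'
    rw [show κ - k - 1 = κ - 1 - k by ring, Complex.cpow_sub (κ - 1) (k : ℂ) hvc, Complex.cpow_natCast]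
    push_cast
    rw [inv_pow]
    ring
  rw [e1, integral_Ioi_two_cpow_mul_exp hs (p := κ - k) (fun n h => hκ (n + k) (by
    push_cast; linear_combination h)), neg_sub, Complex.cpow_sub _ _ hs0, Complex.cpow_natCast,
    Complex.cpow_neg]
  ring

/-! ### The singular part of the moments -/

/-- The regularised integral of `v ^ c (v - 1) ^ μ` over `(1, ∞)` plus `ε` times the integral of
`v ^ c (1 - v) ^ μ` over `(0, 1)`. -/
def totBeta (μ ε c : ℂ) : ℂ := regBeta μ c + ε * Complex.betaIntegral (c + 1) (μ + 1)

theorem totBeta_succ {μ : ℂ} (hμ : -1 < μ.re) (ε : ℂ) {c : ℂ} (hc : -1 < c.re)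
    (hκ : ∀ n : ℤ, c + μ + 1 ≠ n) :
    (c + μ + 2) * totBeta μ ε (c + 1) = (c + 1) * totBeta μ ε c := by
  have h1 := regBeta_succ hμ c hκ
  have hc0 : c + 1 ≠ 0 := fun h => by
    have := congrArg Complex.re h
    simp at this
    linarith
  have hk0 : c + μ + 2 ≠ 0 := fun h => hκ (-1) (by push_cast; linear_combination h)
  have h2 : (c + μ + 2) * Complex.betaIntegral (c + 1 + 1) (μ + 1) =
      (c + 1) * Complex.betaIntegral (c + 1) (μ + 1) := by
    rw [Complex.betaIntegral_eq_Gamma_mul_div _ _ (by simp; linarith) (by simp; linarith),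
      Complex.betaIntegral_eq_Gamma_mul_div _ _ (by simp; linarith) (by simp; linarith),
      Complex.Gamma_add_one _ hc0, show c + 1 + 1 + (μ + 1) = c + μ + 2 + 1 by ring,
      Complex.Gamma_add_one _ hk0, show c + 1 + (μ + 1) = c + μ + 2 by ring]
    field_simp
  simp only [totBeta]
  linear_combination h1 + ε * h2

/-- The quotient of rising factorials `(c + 1)_j / (c + μ + 2)_j`. -/
def riseRatio (μ c : ℂ) (j : ℕ) : ℂ := ∏ i ∈ Finset.range j, (c + 1 + i) / (c + μ + 2 + i)

/-- This is why one constant governs the singular part of every moment: its dependence on ξ is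
entirely in `totBeta μ ε c`, and the index enters through `riseRatio` alone. -/
theorem totBeta_add_nat {μ : ℂ} (hμ : -1 < μ.re) (ε : ℂ) {c : ℂ} (hc : -1 < c.re)
    (hκ : ∀ n : ℤ, c + μ + 1 ≠ n) (j : ℕ) :
    totBeta μ ε (c + j) = totBeta μ ε c * riseRatio μ c j := by
  induction j with
  | zero => simp [riseRatio]
  | succ j ih =>
    have hκj : ∀ n : ℤ, c + j + μ + 1 ≠ n := fun n h => hκ (n - j) (by
      push_cast; linear_combination h)
    have hj := totBeta_succ hμ ε (c := c + j) (by
      have : (0 : ℝ) ≤ j := j.cast_nonneg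
      simp; linarith) hκj
    have h0 : c + μ + 2 + j ≠ 0 := fun h => hκj (-1) (by push_cast; linear_combination h)
    rw [riseRatio, Finset.prod_range_succ, ← riseRatio, ← mul_assoc, ← ih,
      show c + ((j + 1 : ℕ) : ℂ) = c + j + 1 by push_cast; ring]
    field_simp
    linear_combination hj

/-- Each factor equals 1 - (μ + 1)/(c + μ + 2 + i), which is bounded uniformly in i. -/
theorem exists_norm_riseRatio_le {μ c : ℂ} (hκ : ∀ n : ℤ, c + μ + 1 ≠ n) :
    ∃ C > 0, ∀ j, ‖riseRatio μ c j‖ ≤ C ^ j := by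
  obtain ⟨δ, hδ, h⟩ := exists_le_norm_add_int hκ
  refine ⟨1 + ‖μ + 1‖ / δ, by positivity, fun j => ?_⟩
  rw [riseRatio, norm_prod]
  refine (Finset.prod_le_prod (g := fun _ => 1 + ‖μ + 1‖ / δ) (fun _ _ => norm_nonneg _)
    fun i _ => ?_).trans_eq (by simp)
  have hi := h (i + 1 : ℕ)
  push_cast at hi
  rw [show c + μ + 1 + ((i : ℂ) + 1) = c + μ + 2 + i by ring] at hi
  have h0 : c + μ + 2 + i ≠ 0 := norm_pos_iff.1 (hδ.trans_le hi)
  rw [show (c + 1 + i) / (c + μ + 2 + i) = 1 - (μ + 1) / (c + μ + 2 + i) by field_simp; ring]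
  refine (norm_sub_le _ _).trans ?_
  rw [norm_one, norm_div]
  gcongr

/-- The analytic factor of the singular part of the moments. -/
def momentB (μ a : ℂ) (n : ℕ) (z : ℂ) : ℂ :=
  ∑' m : ℕ, (-1) ^ m / (m.factorial : ℂ) * riseRatio μ a (n + m) * z ^ m

theorem summable_momentB {μ a : ℂ} (hκ : ∀ n : ℤ, a + μ + 1 ≠ n) (n : ℕ) {r : ℝ} (hr : 0 ≤ r) :
    Summable fun m : ℕ => ‖(-1) ^ m / (m.factorial : ℂ) * riseRatio μ a (n + m)‖ * r ^ m := by
  obtain ⟨C, hC, h⟩ := exists_norm_riseRatio_le hκ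
  refine Summable.of_nonneg_of_le (fun m => by positivity) (fun m => ?_)
    ((Real.summable_pow_div_factorial (C * r)).mul_left (C ^ n))
  simp only [norm_mul, norm_div, norm_pow, norm_neg, norm_one, one_pow, Complex.norm_natCast]
  calc 1 / (m.factorial : ℝ) * ‖riseRatio μ a (n + m)‖ * r ^ m
      ≤ 1 / (m.factorial : ℝ) * C ^ (n + m) * r ^ m := by gcongr; exact h _
    _ = _ := by rw [mul_pow, pow_add]; ring

theorem analyticAt_momentB {μ a : ℂ} (hκ : ∀ n : ℤ, a + μ + 1 ≠ n) (n : ℕ) :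
    AnalyticAt ℂ (momentB μ a n) 0 :=
  (hasFPowerSeriesAt_tsum_pow one_pos (summable_momentB hκ n zero_le_one)).analyticAt

theorem momentB_zero_zero (μ a : ℂ) : momentB μ a 0 0 = 1 := by
  simp [momentB, tsum_pow_zero, riseRatio]

theorem betaIntegral_eq_setIntegral (c μ : ℂ) (m : ℕ) :
    Complex.betaIntegral (c + m + 1) (μ + 1) =
      ∫ v in Set.Ioc (0 : ℝ) 1, (v : ℂ) ^ c * (1 - (v : ℂ)) ^ μ * (v : ℂ) ^ m := by
  rw [Complex.betaIntegral, intervalIntegral.integral_of_le zero_le_one]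
  refine setIntegral_congr_fun measurableSet_Ioc fun v hv => ?_
  have hvc : (v : ℂ) ≠ 0 := by exact_mod_cast hv.1.ne'
  simp only [add_sub_cancel_right]
  rw [Complex.cpow_add _ _ hvc, Complex.cpow_natCast]
  ring

theorem integrableOn_Ioc_zero_one {c μ : ℂ} (hc : -1 < c.re) (hμ : -1 < μ.re) :
    IntegrableOn (fun v : ℝ => (v : ℂ) ^ c * (1 - (v : ℂ)) ^ μ) (Set.Ioc 0 1) := by
  have h := Complex.betaIntegral_convergent (u := c + 1) (v := μ + 1) (by simp; linarith)
    (by simp; linarith)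
  simpa [intervalIntegrable_iff_integrableOn_Ioc_of_le] using h

/-- Adds the exponential expansions on (0, 1] and (1, 2] to that of the tail. Together the
coefficients of (-s)^m/m! form the finite part over (0, ∞) at exponent c + m. -/
theorem hasSum_totBeta {μ c : ℂ} (hc : -1 < c.re) (hμ : -1 < μ.re) (ε : ℂ) {δ : ℝ} (hδ : 0 < δ)
    (h : ∀ n : ℤ, δ ≤ ‖c + μ + 1 + n‖) {s : ℝ} (hs : 0 < s) (hsδ : s ≤ δ / 2) :
    HasSum (fun m : ℕ => (-(s : ℂ)) ^ m / m.factorial * totBeta μ ε (c + m))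
      (ε * (∫ v in Set.Ioc (0 : ℝ) 1, (v : ℂ) ^ c * (1 - (v : ℂ)) ^ μ * Complex.exp (-(s * v))) +
        (∫ v in Set.Ioc (1 : ℝ) 2, (v : ℂ) ^ c * ((v : ℂ) - 1) ^ μ * Complex.exp (-(s * v))) +
        (∫ v in Set.Ioi (2 : ℝ), (v : ℂ) ^ c * ((v : ℂ) - 1) ^ μ * Complex.exp (-(s * v))) -
        (s : ℂ) ^ (-(c + μ + 1)) * momentA μ (c + μ + 1) s) := by
  have h1 := (hasSum_integral_mul_exp measurableSet_Ioc (Set.Ioc_subset_Icc_self.trans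
    (Set.Icc_subset_Icc_right one_le_two)) (integrableOn_Ioc_zero_one hc hμ) (s : ℂ)).mul_left ε
  have h2 := hasSum_integral_mul_exp measurableSet_Ioc (Set.Ioc_subset_Icc_self.trans
    (Set.Icc_subset_Icc_left zero_le_one)) (integrableOn_Ioc_one_two hμ c) (s : ℂ)
  have h3 := hasSum_integral_Ioi_two μ c hδ h hs hsδ
  rw [add_sub_assoc, ← neg_sub ((s : ℂ) ^ (-(c + μ + 1)) * momentA μ (c + μ + 1) s), ← sub_eq_add_neg]
  refine hasSum_of_forall_eq ((h1.add h2).sub h3) fun m => ?_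
  rw [totBeta, betaIntegral_eq_setIntegral, regBeta]
  have e : ∫ v in Set.Ioc (1 : ℝ) 2, (v : ℂ) ^ (c + m) * ((v : ℂ) - 1) ^ μ =
      ∫ v in Set.Ioc (1 : ℝ) 2, (v : ℂ) ^ c * ((v : ℂ) - 1) ^ μ * (v : ℂ) ^ m := by
    refine setIntegral_congr_fun measurableSet_Ioc fun v hv => ?_
    have hvc : (v : ℂ) ≠ 0 := by exact_mod_cast (one_pos.trans hv.1).ne'
    rw [Complex.cpow_add _ _ hvc, Complex.cpow_natCast]
    ring
  rw [e]
  simp only [show ∀ k : ℕ, c + m + μ + 1 - k = c + μ + 1 + m - k from fun k => by ring]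
  ring

/-! ### The deformed weight and its moments -/

/-- The deformed Laguerre weight after the substitution `x = s v`. -/
def scaledWeight (μ ξ c : ℂ) (s v : ℝ) : ℂ :=
  (1 - ξ * (Set.Ioo 0 1).indicator (fun _ => (1 : ℂ)) v) * ((v - 1 : ℝ) : ℂ) ^ μ *
    ((v : ℂ) ^ c * Complex.exp (-(s * v)))

theorem ofReal_neg_cpow {x : ℝ} (hx : 0 < x) (μ : ℂ) :
    ((-x : ℝ) : ℂ) ^ μ = Complex.exp (Real.pi * Complex.I * μ) * (x : ℂ) ^ μ := by
  have h := Complex.ofReal_cpow_of_nonpos (x := -x) (by linarith) μ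
  rw [h]
  simp
  ring

theorem scaledWeight_eq_of_lt_one (μ ξ c : ℂ) (s : ℝ) {v : ℝ} (hv : v ∈ Set.Ioo (0 : ℝ) 1) :
    (1 - ξ) * Complex.exp (Real.pi * Complex.I * μ) *
      ((v : ℂ) ^ c * (1 - (v : ℂ)) ^ μ * Complex.exp (-(s * v))) = scaledWeight μ ξ c s v := by
  rw [scaledWeight, Set.indicator_of_mem hv, show v - 1 = -(1 - v) by ring,
    ofReal_neg_cpow (by linarith [hv.2])]
  push_cast
  ring

theorem scaledWeight_eq_of_one_lt (μ ξ c : ℂ) (s : ℝ) {v : ℝ} (hv : 1 < v) :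
    (v : ℂ) ^ c * ((v : ℂ) - 1) ^ μ * Complex.exp (-(s * v)) = scaledWeight μ ξ c s v := by
  rw [scaledWeight, Set.indicator_of_notMem (fun h => by linarith [h.2])]
  push_cast
  ring

theorem integral_scaledWeight {μ c : ℂ} (hc : -1 < c.re) (hμ : -1 < μ.re) (ξ : ℂ) {s : ℝ}
    (hs : 0 < s) : IntegrableOn (scaledWeight μ ξ c s) (Set.Ioi 0) ∧
    ∫ v in Set.Ioi (0 : ℝ), scaledWeight μ ξ c s v =
      (1 - ξ) * Complex.exp (Real.pi * Complex.I * μ) *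
      (∫ v in Set.Ioc (0 : ℝ) 1, (v : ℂ) ^ c * (1 - (v : ℂ)) ^ μ * Complex.exp (-(s * v))) +
        (∫ v in Set.Ioc (1 : ℝ) 2, (v : ℂ) ^ c * ((v : ℂ) - 1) ^ μ * Complex.exp (-(s * v))) +
        (∫ v in Set.Ioi (2 : ℝ), (v : ℂ) ^ c * ((v : ℂ) - 1) ^ μ * Complex.exp (-(s * v))) := by
  have hexp : Continuous fun v : ℝ => Complex.exp (-(s * v)) := by fun_prop
  have j1 : IntegrableOn (fun v : ℝ => (v : ℂ) ^ c * (1 - (v : ℂ)) ^ μ * Complex.exp (-(s * v)))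
      (Set.Ioc 0 1) := by
    have := (integrableOn_Ioc_zero_one hc hμ).continuousOn_mul_of_subset hexp.continuousOn
      isCompact_Icc measurableSet_Ioc Set.Ioc_subset_Icc_self
    simpa only [mul_comm] using this
  have j2 : IntegrableOn (fun v : ℝ => (v : ℂ) ^ c * ((v : ℂ) - 1) ^ μ * Complex.exp (-(s * v)))
      (Set.Ioc 1 2) := by
    have := (integrableOn_Ioc_one_two hμ c).continuousOn_mul_of_subset hexp.continuousOn
      isCompact_Icc measurableSet_Ioc Set.Ioc_subset_Icc_self
    simpa only [mul_comm] using this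
  have j3 := integrableOn_Ioi_two μ c hs
  have k1 : IntegrableOn (scaledWeight μ ξ c s) (Set.Ioc 0 1) := by
    rw [integrableOn_Ioc_iff_integrableOn_Ioo] at j1 ⊢
    exact IntegrableOn.congr_fun (j1.const_mul _) (fun v hv => scaledWeight_eq_of_lt_one μ ξ c s hv)
      measurableSet_Ioo
  have k2 : IntegrableOn (scaledWeight μ ξ c s) (Set.Ioc 1 2) :=
    j2.congr_fun (fun v hv => scaledWeight_eq_of_one_lt μ ξ c s hv.1) measurableSet_Ioc
  have k3 : IntegrableOn (scaledWeight μ ξ c s) (Set.Ioi 2) :=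
    j3.congr_fun (fun v hv => scaledWeight_eq_of_one_lt μ ξ c s (one_lt_two.trans hv))
      measurableSet_Ioi
  have k23 : IntegrableOn (scaledWeight μ ξ c s) (Set.Ioi 1) := by
    rw [← Set.Ioc_union_Ioi_eq_Ioi (one_le_two (α := ℝ))]
    exact k2.union k3
  refine ⟨?_, ?_⟩
  · rw [← Set.Ioc_union_Ioi_eq_Ioi (zero_le_one (α := ℝ))]
    exact k1.union k23
  · rw [← Set.Ioc_union_Ioi_eq_Ioi (zero_le_one (α := ℝ)),
      setIntegral_union (Set.Ioc_disjoint_Ioi le_rfl) measurableSet_Ioi k1 k23,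
      ← Set.Ioc_union_Ioi_eq_Ioi (one_le_two (α := ℝ)),
      setIntegral_union (Set.Ioc_disjoint_Ioi le_rfl) measurableSet_Ioi k2 k3, ← add_assoc]
    refine congrArg₂ (· + ·) (congrArg₂ (· + ·) ?_ ?_) ?_
    · rw [← integral_const_mul, integral_Ioc_eq_integral_Ioo, integral_Ioc_eq_integral_Ioo]
      exact setIntegral_congr_fun measurableSet_Ioo
        fun v hv => (scaledWeight_eq_of_lt_one μ ξ c s hv).symm
    · exact setIntegral_congr_fun measurableSet_Ioc
        fun v hv => (scaledWeight_eq_of_one_lt μ ξ c s hv.1).symm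
    · exact setIntegral_congr_fun measurableSet_Ioi
        fun v hv => (scaledWeight_eq_of_one_lt μ ξ c s (one_lt_two.trans hv)).symm

/-- The one-particle weight of the deformed ensemble. -/
def deformedWeight (a μ ξ : ℂ) (s x : ℝ) : ℂ :=
  (1 - ξ * (Set.Ioo 0 s).indicator (fun _ => (1 : ℂ)) x) * ((x - s : ℝ) : ℂ) ^ μ *
    ((x : ℂ) ^ a * Complex.exp (-(x : ℂ)))

/-- Multiplication by a positive number leaves the argument unchanged, so the rule holds on the
principal branch for negative x too, as needed for (x - s)^μ with x < s. -/
theorem ofReal_mul_cpow {s : ℝ} (hs : 0 < s) (x : ℝ) (μ : ℂ) :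
    ((s * x : ℝ) : ℂ) ^ μ = (s : ℂ) ^ μ * (x : ℂ) ^ μ := by
  have hs0 : (s : ℂ) ≠ 0 := by exact_mod_cast hs.ne'
  rcases eq_or_ne x 0 with rfl | hx
  · rcases eq_or_ne μ 0 with rfl | hμ <;> simp [Complex.zero_cpow, *]
  · have hx0 : (x : ℂ) ≠ 0 := by exact_mod_cast hx
    rw [Complex.ofReal_mul, Complex.cpow_def_of_ne_zero (mul_ne_zero hs0 hx0),
      Complex.log_ofReal_mul hs hx0, Complex.cpow_def_of_ne_zero hs0,
      Complex.cpow_def_of_ne_zero hx0, ← Complex.exp_add, Complex.ofReal_log hs.le, add_mul]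

theorem deformedWeight_mul (a μ ξ : ℂ) (n : ℕ) {s v : ℝ} (hs : 0 < s) (hv : 0 < v) :
    ((s * v : ℝ) : ℂ) ^ n * deformedWeight a μ ξ s (s * v) =
      (s : ℂ) ^ (a + n + μ) * scaledWeight μ ξ (a + n) s v := by
  have hs0 : (s : ℂ) ≠ 0 := by exact_mod_cast hs.ne'
  have hv0 : (v : ℂ) ≠ 0 := by exact_mod_cast hv.ne'
  have hind : (Set.Ioo 0 s).indicator (fun _ => (1 : ℂ)) (s * v) =
      (Set.Ioo 0 1).indicator (fun _ => (1 : ℂ)) v := by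
    simp only [Set.indicator, Set.mem_Ioo, mul_pos_iff_of_pos_left hs, mul_lt_iff_lt_one_right hs]
  rw [deformedWeight, scaledWeight, hind, show s * v - s = s * (v - 1) by ring,
    ofReal_mul_cpow hs, ofReal_mul_cpow hs, Complex.cpow_add _ _ hs0, Complex.cpow_add _ _ hs0,
    Complex.cpow_add _ _ hv0, Complex.cpow_natCast, Complex.cpow_natCast]
  push_cast
  ring

theorem integrableOn_deformedWeight {a μ : ℂ} (ha : -1 < a.re) (hμ : -1 < μ.re) (ξ : ℂ) (n : ℕ)
    {s : ℝ} (hs : 0 < s) :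
    IntegrableOn (fun x : ℝ => (x : ℂ) ^ n * deformedWeight a μ ξ s x) (Set.Ioi 0) := by
  have hc : -1 < (a + n).re := by
    have : (0 : ℝ) ≤ n := n.cast_nonneg
    simp; linarith
  have h := IntegrableOn.congr_fun
    ((integral_scaledWeight hc hμ ξ hs).1.const_mul ((s : ℂ) ^ (a + n + μ))) (fun v hv => (deformedWeight_mul a μ ξ n hs hv).symm) measurableSet_Ioi
  rw [← mul_zero s]
  exact (integrableOn_Ioi_comp_mul_left_iff _ _ hs).1 (by simpa using h)

/-- An exact identity, not an asymptotic one. The substitution x = s v contributes s^{a+n+μ+1},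
which cancels the power in front of `momentA` and becomes s^κ s^n in front of the singular series.
The bound δ/2 is a radius on which `momentA` converges. -/
theorem integral_deformedWeight {a μ : ℂ} (ha : -1 < a.re) (hμ : -1 < μ.re) (ξ : ℂ) {δ : ℝ}
    (hδ : 0 < δ) (h : ∀ n : ℤ, δ ≤ ‖a + μ + 1 + n‖) (n : ℕ) {s : ℝ} (hs : 0 < s)
    (hsδ : s ≤ δ / 2) :
    ∫ x in Set.Ioi (0 : ℝ), (x : ℂ) ^ n * deformedWeight a μ ξ s x =
      momentA μ (a + μ + 1 + n) s +
        totBeta μ ((1 - ξ) * Complex.exp (Real.pi * Complex.I * μ)) a * (s : ℂ) ^ (a + μ + 1) *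
          ((s : ℂ) ^ n * momentB μ a n s) := by
  have hs0 : (s : ℂ) ≠ 0 := by exact_mod_cast hs.ne'
  set ε := (1 - ξ) * Complex.exp (Real.pi * Complex.I * μ)
  have hκ : ∀ n : ℤ, a + μ + 1 ≠ n := fun n hn => by
    have := h (-n)
    rw [hn] at this
    simp at this
    linarith
  have hc : -1 < (a + n).re := by
    have : (0 : ℝ) ≤ n := n.cast_nonneg
    simp; linarith
  have h' : ∀ m : ℤ, δ ≤ ‖a + n + μ + 1 + m‖ := fun m => by
    have := h (n + m)
    push_cast at this
    rwa [show a + μ + 1 + ((n : ℂ) + m) = a + n + μ + 1 + m by ring] at this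
  have h1 := hasSum_totBeta hc hμ ε hδ h' hs hsδ
  have h2 : HasSum (fun m : ℕ => (-(s : ℂ)) ^ m / m.factorial * totBeta μ ε (a + n + m))
      (totBeta μ ε a * momentB μ a n s) := by
    have h3 : Summable fun m : ℕ => (-1) ^ m / (m.factorial : ℂ) * riseRatio μ a (n + m) *
        (s : ℂ) ^ m := by
      refine Summable.of_norm ((summable_momentB hκ n hs.le).congr fun m => ?_)
      rw [norm_mul _ ((s : ℂ) ^ m), norm_pow, Complex.norm_real, Real.norm_of_nonneg hs.le]
    refine hasSum_of_forall_eq (h3.hasSum.mul_left (totBeta μ ε a)) fun m => ?_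
    rw [show a + n + (m : ℂ) = a + ((n + m : ℕ) : ℂ) by push_cast; ring,
      totBeta_add_nat hμ ε ha hκ, neg_pow]
    ring
  have e := h1.unique h2
  have hscale := integral_comp_mul_left_Ioi
    (fun x : ℝ => (x : ℂ) ^ n * deformedWeight a μ ξ s x) 0 hs
  rw [mul_zero, setIntegral_congr_fun measurableSet_Ioi
    (fun v hv => deformedWeight_mul a μ ξ n hs hv), integral_const_mul,
    (integral_scaledWeight hc hμ ξ hs).2] at hscale
  rw [sub_eq_iff_eq_add] at e
  rw [e] at hscale
  have h4 : ∫ x in Set.Ioi (0 : ℝ), (x : ℂ) ^ n * deformedWeight a μ ξ s x =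
      s * ((s : ℂ) ^ (a + n + μ) * (totBeta μ ε a * momentB μ a n s +
        (s : ℂ) ^ (-(a + n + μ + 1)) * momentA μ (a + n + μ + 1) s)) := by
    rw [hscale, Complex.real_smul, ← mul_assoc, Complex.ofReal_inv, mul_inv_cancel₀ hs0, one_mul]
  rw [h4, Complex.cpow_neg, Complex.cpow_add _ 1 hs0, Complex.cpow_one,
    show a + n + μ + 1 = a + μ + 1 + n by ring, show a + n + μ = a + μ + n by ring,
    Complex.cpow_add _ 1 hs0, Complex.cpow_one, Complex.cpow_add _ (n : ℂ) hs0,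
    Complex.cpow_natCast]
  have h5 : (s : ℂ) ^ (a + μ) ≠ 0 := by simp [Complex.cpow_eq_zero_iff, hs0]
  field_simp
  ring

/-- The reflection formula is applied to Γ(-a) and to Γ(-(a+μ+1)). The quotient of the two sines
comes from the integral over (1, ∞), and ε from the one over (0, 1). -/
theorem totBeta_eq {a μ : ℂ} (ha : -1 < a.re) (hμ : -1 < μ.re) (hκ : ∀ n : ℤ, a + μ + 1 ≠ n)
    (ε : ℂ) :
    totBeta μ ε a = Complex.Gamma (μ + 1) * Complex.Gamma (a + 1) / Complex.Gamma (μ + a + 2) *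
      (ε - Complex.sin (Real.pi * a) / Complex.sin (Real.pi * (μ + a))) := by
  have g1 := Complex.Gamma_mul_Gamma_one_sub (-a)
  have g2 := Complex.Gamma_mul_Gamma_one_sub (-(a + μ + 1))
  have hπ : (Real.pi : ℂ) ≠ 0 := by exact_mod_cast Real.pi_ne_zero
  have hΓ1 : Complex.Gamma (a + 1) ≠ 0 := Complex.Gamma_ne_zero_of_re_pos (by simp; linarith)
  have hΓ2 : Complex.Gamma (μ + a + 2) ≠ 0 := Complex.Gamma_ne_zero fun m h => hκ (-m - 1) (by
    push_cast; linear_combination h)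
  have hsin : Complex.sin (Real.pi * (μ + a)) ≠ 0 := fun h => by
    obtain ⟨k, hk⟩ := Complex.sin_eq_zero_iff.1 h
    apply hκ (k + 1)
    have : μ + a = k := mul_left_cancel₀ hπ (by rw [hk]; ring)
    push_cast
    linear_combination this
  rw [show Real.pi * -(a + μ + 1) = -(Real.pi * (μ + a) + Real.pi) by ring, Complex.sin_neg,
    Complex.sin_add_pi, neg_neg, show 1 - -(a + μ + 1) = μ + a + 2 by ring] at g2
  rw [mul_neg, Complex.sin_neg, show 1 - -a = a + 1 by ring, div_neg] at g1
  -- Stated for the inverse, since a may be a nonnegative integer; both sides are then 0.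
  have i1 : (Complex.Gamma (-a))⁻¹ =
      -(Complex.Gamma (a + 1) * Complex.sin (Real.pi * a) / Real.pi) := by
    rw [eq_div_of_mul_eq hΓ1 g1]
    simp
    field_simp
  rw [totBeta, regBeta_eq hμ hκ, Complex.betaIntegral_eq_Gamma_mul_div _ _ (by simp; linarith)
    (by simp; linarith), div_eq_mul_inv, i1, eq_div_of_mul_eq hΓ2 g2,
    show a + 1 + (μ + 1) = μ + a + 2 by ring]
  field_simp
  ring

/-! ### The average as a Hankel determinant -/

theorem restrict_univ_pi_Ioi (N : ℕ) :
    (volume : Measure (Fin N → ℝ)).restrict (Set.univ.pi fun _ => Set.Ioi 0) =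
      Measure.pi fun _ : Fin N => (volume : Measure ℝ).restrict (Set.Ioi 0) := by
  rw [volume_pi, Measure.restrict_pi_pi]

theorem integral_lueWeight (N : ℕ) {a : ℂ} (ha : -1 < a.re) :
    ∫ x in Set.univ.pi (fun _ : Fin N => Set.Ioi (0 : ℝ)), lueWeight N a x =
      N.factorial * lueC N a := by
  have hΓ : ∀ n : ℕ, IntegrableOn
      (fun x : ℝ => (x : ℂ) ^ n * ((x : ℂ) ^ a * Complex.exp (-(x : ℂ)))) (Set.Ioi 0) ∧
      ∫ x in Set.Ioi (0 : ℝ), (x : ℂ) ^ n * ((x : ℂ) ^ a * Complex.exp (-(x : ℂ))) =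
        Complex.Gamma (a + 1 + n) := by
    intro n
    have hre : 0 < (a + 1 + n).re := by
      have : (0 : ℝ) ≤ n := n.cast_nonneg
      simp; linarith
    have e : Set.EqOn (fun x : ℝ => (Real.exp (-x) : ℂ) * (x : ℂ) ^ (a + 1 + n - 1))
        (fun x : ℝ => (x : ℂ) ^ n * ((x : ℂ) ^ a * Complex.exp (-(x : ℂ)))) (Set.Ioi 0) := by
      intro x hx
      have hx0 : (x : ℂ) ≠ 0 := by exact_mod_cast (ne_of_gt hx)
      simp only
      rw [show a + 1 + n - 1 = a + (n : ℂ) by ring, Complex.cpow_add _ _ hx0, Complex.cpow_natCast]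
      push_cast
      ring
    refine ⟨(Complex.GammaIntegral_convergent hre).congr_fun e measurableSet_Ioi, ?_⟩
    rw [Complex.Gamma_eq_integral hre, Complex.GammaIntegral]
    exact (setIntegral_congr_fun measurableSet_Ioi e).symm
  have h := integral_prod_mul_vandermonde_sq N (volume.restrict (Set.Ioi 0))
    (fun x : ℝ => (x : ℂ) ^ a * Complex.exp (-(x : ℂ))) (fun n => (hΓ n).1)
  rw [restrict_univ_pi_Ioi]
  simp only [lueWeight]
  rw [h]
  simp only [(hΓ _).2]
  rw [det_Gamma_hankel N (a + 1) fun m h => by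
    have := congrArg Complex.re h
    have h2 : (0 : ℝ) ≤ m := m.cast_nonneg
    simp at this
    linarith]
  simp only [lueC, add_assoc]

theorem lueC_ne_zero (N : ℕ) {a : ℂ} (ha : -1 < a.re) : lueC N a ≠ 0 := by
  refine Finset.prod_ne_zero_iff.2 fun j _ => ?_
  have h2 : (0 : ℝ) ≤ j := j.cast_nonneg
  exact mul_ne_zero (Complex.Gamma_ne_zero_of_re_pos (by simp; linarith))
    (Complex.Gamma_ne_zero_of_re_pos (by simp; linarith))

theorem lueE_eq_det (N : ℕ) {a μ : ℂ} (ha : -1 < a.re) (hμ : -1 < μ.re) (ξ : ℂ) {s : ℝ}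
    (hs : 0 < s) :
    lueE N a μ ξ s = (Matrix.of fun j k : Fin N =>
      ∫ x in Set.Ioi (0 : ℝ), (x : ℂ) ^ ((j : ℕ) + k) * deformedWeight a μ ξ s x).det /
        lueC N (a + μ) := by
  have hC := lueC_ne_zero N ha
  have hf : (N.factorial : ℂ) ≠ 0 := by exact_mod_cast N.factorial_ne_zero
  have h := integral_prod_mul_vandermonde_sq N (volume.restrict (Set.Ioi 0))
    (deformedWeight a μ ξ s) (fun n => integrableOn_deformedWeight ha hμ ξ n hs)
  have e : ∀ x : Fin N → ℝ, (∏ l,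
      ((1 - ξ * (Set.Ioo 0 s).indicator (fun _ => (1 : ℂ)) (x l)) * ((x l - s : ℝ) : ℂ) ^ μ)) *
        lueWeight N a x = (∏ l, deformedWeight a μ ξ s (x l)) *
          ∏ j, ∏ k ∈ Finset.Ioi j, ((x k : ℂ) - (x j : ℂ)) ^ 2 := fun x => by
    simp only [lueWeight, deformedWeight, Finset.prod_mul_distrib]
    ring
  rw [lueE, lueAverage, integral_lueWeight N ha]
  simp only [e]
  rw [restrict_univ_pi_Ioi, h]
  field_simp

/-- Expand along row 0: the perturbation changes only the corner entry, whose cofactor is the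
complementary minor. -/
theorem det_add_smul_single {n : ℕ} (A B : Matrix (Fin (n + 1)) (Fin (n + 1)) ℂ)
    (hB : ∀ j k, B j k = if j = 0 ∧ k = 0 then 1 else 0) (u : ℂ) :
    (Matrix.of fun j k => A j k + u * B j k).det =
      A.det + u * (A.submatrix Fin.succ Fin.succ).det := by
  have hsub : ∀ i : Fin (n + 1), (Matrix.of fun j k => A j k + u * B j k).submatrix Fin.succ
      (Fin.succAbove i) = A.submatrix Fin.succ (Fin.succAbove i) := by
    intro i
    ext j k
    simp [hB, Fin.succ_ne_zero]
  rw [Matrix.det_succ_row_zero, Matrix.det_succ_row_zero A]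
  simp only [hsub]
  simp only [Matrix.of_apply, hB, mul_add, add_mul, Finset.sum_add_distrib]
  congr 1
  rw [Finset.sum_eq_single 0]
  · simp [Fin.succAbove_zero]
  · intro b _ hb
    simp [hb]
  · simp

/-- The ratio of the corner minor, a Hankel determinant with parameter κ + 2, to the full
determinant; it yields Q(0). -/
theorem lueC_succ_ratio (n : ℕ) (κ : ℂ) :
    (∏ j ∈ Finset.range n, Complex.Gamma ((j : ℂ) + 1) * Complex.Gamma ((j : ℂ) + (κ + 2))) *
      (Complex.Gamma (κ + 1) * Complex.Gamma κ * Complex.Gamma (n + 1)) =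
    Complex.Gamma (κ + n + 1) *
      ∏ j ∈ Finset.range (n + 1), Complex.Gamma ((j : ℂ) + 1) * Complex.Gamma ((j : ℂ) + κ) := by
  induction n with
  | zero => simp
  | succ n ih =>
    rw [Finset.prod_range_succ, Finset.prod_range_succ _ (n + 1)]
    push_cast
    rw [show (n : ℂ) + (κ + 2) = κ + (n + 1) + 1 by ring, show (n : ℂ) + 1 + κ = κ + n + 1 by ring]
    linear_combination Complex.Gamma (κ + (n + 1) + 1) * Complex.Gamma (n + 1 + 1) * ih

/-! ### Expansions to first order in w with analytic coefficients -/

/-- `Φ` agrees near the origin with `P(z) + w Q(z) + w² H(z, w)` for analytic `P`, `Q`, `H`. -/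
def HasJet (P Q : ℂ → ℂ) (Φ : ℂ × ℂ → ℂ) : Prop :=
  AnalyticAt ℂ P 0 ∧ AnalyticAt ℂ Q 0 ∧ ∃ H : ℂ × ℂ → ℂ, AnalyticAt ℂ H (0, 0) ∧
    ∀ᶠ p in 𝓝 (0, 0), Φ p = P p.1 + p.2 * Q p.1 + p.2 ^ 2 * H p

theorem AnalyticAt.comp_fst_zero {P : ℂ → ℂ} (hP : AnalyticAt ℂ P 0) :
    AnalyticAt ℂ (fun p : ℂ × ℂ => P p.1) (0, 0) :=
  AnalyticAt.fun_comp (f := Prod.fst) hP analyticAt_fst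

theorem HasJet.of_affine {P Q : ℂ → ℂ} (hP : AnalyticAt ℂ P 0) (hQ : AnalyticAt ℂ Q 0) :
    HasJet P Q fun p => P p.1 + p.2 * Q p.1 :=
  ⟨hP, hQ, 0, analyticAt_const, Eventually.of_forall fun p => by simp⟩

theorem HasJet.const (c : ℂ) : HasJet (fun _ => c) (fun _ => 0) fun _ => c :=
  ⟨analyticAt_const, analyticAt_const, 0, analyticAt_const, Eventually.of_forall fun p => by simp⟩

theorem HasJet.add {P Q P' Q' : ℂ → ℂ} {Φ Ψ : ℂ × ℂ → ℂ} (h : HasJet P Q Φ)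
    (h' : HasJet P' Q' Ψ) : HasJet (P + P') (Q + Q') (fun p => Φ p + Ψ p) := by
  obtain ⟨hP, hQ, H, hH, hΦ⟩ := h
  obtain ⟨hP', hQ', H', hH', hΨ⟩ := h'
  refine ⟨hP.add hP', hQ.add hQ', fun p => H p + H' p, hH.fun_add hH', ?_⟩
  filter_upwards [hΦ, hΨ] with p h1 h2
  rw [h1, h2]
  simp only [Pi.add_apply]
  ring

theorem HasJet.mul {P Q P' Q' : ℂ → ℂ} {Φ Ψ : ℂ × ℂ → ℂ} (h : HasJet P Q Φ)
    (h' : HasJet P' Q' Ψ) :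
    HasJet (fun z => P z * P' z) (fun z => P z * Q' z + Q z * P' z) (fun p => Φ p * Ψ p) := by
  obtain ⟨hP, hQ, H, hH, hΦ⟩ := h
  obtain ⟨hP', hQ', H', hH', hΨ⟩ := h'
  refine ⟨hP.fun_mul hP', (hP.fun_mul hQ').fun_add (hQ.fun_mul hP'), fun p => P p.1 * H' p +
    H p * P' p.1 + Q p.1 * Q' p.1 + p.2 * (Q p.1 * H' p + H p * Q' p.1) + p.2 ^ 2 * (H p * H' p),
    ?_, ?_⟩
  · have hp := hP.comp_fst_zero
    have hp' := hP'.comp_fst_zero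
    have hq := hQ.comp_fst_zero
    have hq' := hQ'.comp_fst_zero
    have hw : AnalyticAt ℂ (fun p : ℂ × ℂ => p.2) (0, 0) := analyticAt_snd
    exact ((((hp.fun_mul hH').fun_add (hH.fun_mul hp')).fun_add (hq.fun_mul hq')).fun_add
      (hw.fun_mul ((hq.fun_mul hH').fun_add (hH.fun_mul hq')))).fun_add
      ((hw.fun_pow 2).fun_mul (hH.fun_mul hH'))
  · filter_upwards [hΦ, hΨ] with p h1 h2
    rw [h1, h2]
    ring

theorem exists_hasJet_sum {ι : Type*} (S : Finset ι) {Φ : ι → ℂ × ℂ → ℂ}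
    (h : ∀ i, ∃ P Q, HasJet P Q (Φ i)) : ∃ P Q, HasJet P Q fun p => ∑ i ∈ S, Φ i p := by
  classical
  induction S using Finset.induction_on with
  | empty => exact ⟨_, _, by simpa using HasJet.const 0⟩
  | insert i S hi ih =>
    obtain ⟨P, Q, h1⟩ := h i
    obtain ⟨P', Q', h2⟩ := ih
    simp only [Finset.sum_insert hi]
    exact ⟨_, _, h1.add h2⟩

theorem exists_hasJet_prod {ι : Type*} (S : Finset ι) {Φ : ι → ℂ × ℂ → ℂ}
    (h : ∀ i, ∃ P Q, HasJet P Q (Φ i)) : ∃ P Q, HasJet P Q fun p => ∏ i ∈ S, Φ i p := by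
  classical
  induction S using Finset.induction_on with
  | empty => exact ⟨_, _, by simpa using HasJet.const 1⟩
  | insert i S hi ih =>
    obtain ⟨P, Q, h1⟩ := h i
    obtain ⟨P', Q', h2⟩ := ih
    simp only [Finset.prod_insert hi]
    exact ⟨_, _, h1.mul h2⟩

/-- Sums and products preserve such expansions, so Leibniz's formula gives one for the determinant.
The coefficients stay implicit and are identified afterwards by setting w = 0 or z = 0. -/
theorem exists_hasJet_det {N : ℕ} {A B : ℂ → Matrix (Fin N) (Fin N) ℂ}
    (hA : ∀ j k, AnalyticAt ℂ (fun z => A z j k) 0) (hB : ∀ j k, AnalyticAt ℂ (fun z => B z j k) 0) :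
    ∃ P Q, HasJet P Q fun p =>
      (Matrix.of fun j k => A p.1 j k + p.2 * B p.1 j k).det := by
  simp only [Matrix.det_apply', Matrix.of_apply]
  refine exists_hasJet_sum _ fun σ => ?_
  obtain ⟨P, Q, h⟩ := exists_hasJet_prod Finset.univ fun i =>
    ⟨_, _, HasJet.of_affine (hA (σ i) i) (hB (σ i) i)⟩
  exact ⟨_, _, (HasJet.const _).mul h⟩

theorem HasJet.eventually_eq_fst {P Q : ℂ → ℂ} {Φ : ℂ × ℂ → ℂ} (h : HasJet P Q Φ) :
    ∀ᶠ z in 𝓝 0, P z = Φ (z, 0) := by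
  obtain ⟨-, -, H, -, hΦ⟩ := h
  have ht : Tendsto (fun z : ℂ => (z, (0 : ℂ))) (𝓝 0) (𝓝 (0, 0)) :=
    Continuous.tendsto (by fun_prop) 0
  filter_upwards [ht.eventually hΦ] with z hz
  simp [hz]

/-- On z = 0, cancel the constant, divide by w ≠ 0 and let w → 0. -/
theorem HasJet.snd_zero_eq {P Q : ℂ → ℂ} {Φ : ℂ × ℂ → ℂ} (h : HasJet P Q Φ) {d e : ℂ}
    (hΦ0 : ∀ w, Φ (0, w) = d + w * e) : Q 0 = e := by
  have hP := h.eventually_eq_fst.self_of_nhds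
  obtain ⟨-, -, H, hH, hΦ⟩ := h
  rw [hΦ0, zero_mul, add_zero] at hP
  have ht : Tendsto (fun w : ℂ => ((0 : ℂ), w)) (𝓝 0) (𝓝 (0, 0)) :=
    Continuous.tendsto (by fun_prop) 0
  have h1 : Tendsto (fun w : ℂ => e - w * H (0, w)) (𝓝[≠] 0) (𝓝 (e - 0 * H (0, 0))) :=
    (tendsto_const_nhds.sub (tendsto_id.mul (hH.continuousAt.tendsto.comp ht))).mono_left
      nhdsWithin_le_nhds
  have h2 : ∀ᶠ w in 𝓝[≠] (0 : ℂ), e - w * H (0, w) = Q 0 := by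
    filter_upwards [(ht.eventually hΦ).filter_mono nhdsWithin_le_nhds,
      self_mem_nhdsWithin] with w hw hw0
    rw [hΦ0, hP] at hw
    apply mul_left_cancel₀ hw0
    linear_combination hw
  have := tendsto_nhds_unique (tendsto_const_nhds.congr' (h2.mono fun _ h => h.symm)) h1
  simpa using this

/-! ### Small s expansions and the logarithmic derivative -/

theorem tendsto_ofReal_cpow_pair {κ : ℂ} (hκ : 0 < κ.re) :
    Tendsto (fun s : ℝ => ((s : ℂ), (s : ℂ) ^ κ)) (𝓝[>] 0) (𝓝 (0, 0)) := by
  have hκ0 : κ ≠ 0 := fun h => by simp [h] at hκ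
  have h1 : Tendsto (fun s : ℝ => (s : ℂ)) (𝓝 0) (𝓝 0) :=
    Complex.continuous_ofReal.tendsto' 0 0 (by simp)
  have h2 : Tendsto (fun s : ℝ => (s : ℂ) ^ κ) (𝓝 0) (𝓝 0) := by
    have := (Complex.continuousAt_ofReal_cpow_const 0 κ (Or.inl hκ)).tendsto
    simpa [Complex.zero_cpow hκ0] using this
  exact (h1.prodMk_nhds h2).mono_left nhdsWithin_le_nhds

theorem cpow_two_mul (z κ : ℂ) : z ^ (2 * κ) = (z ^ κ) ^ 2 := by
  rw [mul_comm, Complex.cpow_mul_ofNat]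

theorem hasSmallExpansion_of_eventually {κ β c₁ : ℂ} {P Q : ℂ → ℂ} {H : ℂ × ℂ → ℂ} {F : ℝ → ℂ}
    (hκ : 0 < κ.re) (hP : AnalyticAt ℂ P 0) (hP1 : HasDerivAt P c₁ 0) (hQ : AnalyticAt ℂ Q 0)
    (hQ0 : Q 0 ≠ 0) (hH : AnalyticAt ℂ H (0, 0))
    (hF : ∀ᶠ s : ℝ in 𝓝[>] 0, F s = P s + β * (s : ℂ) ^ κ * Q s +
      ((s : ℂ) ^ κ) ^ 2 * H ((s : ℂ), (s : ℂ) ^ κ)) :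
    HasSmallExpansion κ (P 0) c₁ (β * Q 0) F := by
  -- Normalising Q by Q(0) ≠ 0, rather than by β Q(0), keeps the factor 1 + O(s) meaningful even
  -- when β = 0.
  refine ⟨fun z => P z - P 0 - c₁ * z, fun z => Q z / Q 0 - 1, H,
    fun s => (s : ℂ) ^ (2 * κ) * H ((s : ℂ), (s : ℂ) ^ κ), ?_, ?_, ?_, ?_, hH,
    Eventually.of_forall fun _ => rfl, ?_, ?_⟩
  · exact (hP.fun_sub analyticAt_const).fun_sub (analyticAt_const.fun_mul analyticAt_id)
  · obtain ⟨p, hp⟩ := hP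
    have h := hp.isBigO_sub_partialSum_pow 2
    simp only [zero_add] at h
    have e1 : p.coeff 1 = c₁ := hp.hasDerivAt.unique hP1
    refine (h.congr_left fun z => ?_).trans (IsBigO.of_norm_right (by
      simp only [norm_pow]
      exact isBigO_refl _ _))
    simp only [FormalMultilinearSeries.partialSum, Finset.sum_range_succ, Finset.range_zero,
      Finset.sum_empty, zero_add, FormalMultilinearSeries.apply_eq_pow_smul_coeff, pow_zero, pow_one,
      e1, smul_eq_mul]
    have e2 : p.coeff 0 = P 0 := by
      rw [FormalMultilinearSeries.coeff, hp.coeff_zero]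
    rw [e2]
    ring
  · exact (hQ.fun_div analyticAt_const hQ0).fun_sub analyticAt_const
  · have h := hQ.differentiableAt.isBigO_sub
    simp only [sub_zero] at h
    refine (h.const_mul_left (Q 0)⁻¹).congr_left fun z => ?_
    field_simp
  · have h1 : (fun s : ℝ => H ((s : ℂ), (s : ℂ) ^ κ)) =O[𝓝[>] 0] (fun _ => (1 : ℂ)) :=
      (hH.continuousAt.tendsto.comp (tendsto_ofReal_cpow_pair hκ)).isBigO_one ℂ
    simpa using (isBigO_refl (fun s : ℝ => (s : ℂ) ^ (2 * κ)) (𝓝[>] 0)).mul h1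
  · filter_upwards [hF] with s hs
    rw [hs, cpow_two_mul]
    field_simp
    ring

theorem analyticAt_fderiv_apply {H : ℂ × ℂ → ℂ} (hH : AnalyticAt ℂ H (0, 0)) (v : ℂ × ℂ) :
    AnalyticAt ℂ (fun p => fderiv ℂ H p v) (0, 0) :=
  ((ContinuousLinearMap.apply ℂ ℂ v).analyticAt _).comp hH.fderiv

theorem hasDerivAt_comp_ofReal_cpow_pair {H : ℂ × ℂ → ℂ} {κ : ℂ} {s : ℝ} (hs : 0 < s)
    (hH : DifferentiableAt ℂ H ((s : ℂ), (s : ℂ) ^ κ)) :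
    HasDerivAt (fun t : ℝ => H ((t : ℂ), (t : ℂ) ^ κ))
      (fderiv ℂ H ((s : ℂ), (s : ℂ) ^ κ) (1, 0) +
        κ * (s : ℂ) ^ (κ - 1) * fderiv ℂ H ((s : ℂ), (s : ℂ) ^ κ) (0, 1)) s := by
  have h1 := (hasDerivAt_id (s : ℂ)).cpow_const (c := κ) (Complex.ofReal_mem_slitPlane.2 hs)
  have h2 := (hasDerivAt_id (s : ℂ)).prodMk h1
  have h3 := (HasFDerivAt.comp_hasDerivAt (f := fun z : ℂ => (id z, id z ^ κ)) (s : ℂ)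
    hH.hasFDerivAt h2).comp_ofReal
  refine h3.congr_deriv ?_
  have e : ((1 : ℂ), κ * id (s : ℂ) ^ (κ - 1) * 1) =
      (1, 0) + (κ * (s : ℂ) ^ (κ - 1)) • ((0 : ℂ), (1 : ℂ)) := by
    simp
  rw [e, map_add, map_smul, smul_eq_mul]

/-- The small `s` expansion of `s F'(s)`, for `F(s) = P(s) + β s ^ κ Q(s) + s ^ (2κ) H(s, s ^ κ)`. -/
theorem eventually_hasDerivAt_expansion {κ β : ℂ} {P Q : ℂ → ℂ} {H : ℂ × ℂ → ℂ} {F : ℝ → ℂ}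
    (hκ : 0 < κ.re) (hP : AnalyticAt ℂ P 0) (hQ : AnalyticAt ℂ Q 0) (hH : AnalyticAt ℂ H (0, 0))
    (hF : ∀ᶠ s : ℝ in 𝓝[>] 0, F s = P s + β * (s : ℂ) ^ κ * Q s +
      ((s : ℂ) ^ κ) ^ 2 * H ((s : ℂ), (s : ℂ) ^ κ)) :
    ∀ᶠ s : ℝ in 𝓝[>] 0, ∃ F', HasDerivAt F F' s ∧
      s * F' = s * deriv P s + β * (s : ℂ) ^ κ * (s * deriv Q s + κ * Q s) +
        ((s : ℂ) ^ κ) ^ 2 * (s * fderiv ℂ H ((s : ℂ), (s : ℂ) ^ κ) (1, 0) +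
          κ * (s : ℂ) ^ κ * fderiv ℂ H ((s : ℂ), (s : ℂ) ^ κ) (0, 1) +
          2 * κ * H ((s : ℂ), (s : ℂ) ^ κ)) := by
  have hpair := tendsto_ofReal_cpow_pair hκ
  have hfst : Tendsto (fun s : ℝ => (s : ℂ)) (𝓝[>] 0) (𝓝 0) :=
    (continuous_fst.tendsto (0, 0)).comp hpair
  filter_upwards [self_mem_nhdsWithin, eventually_eventually_nhdsWithin.2 hF,
    hfst.eventually hP.eventually_analyticAt, hfst.eventually hQ.eventually_analyticAt,
    hpair.eventually hH.eventually_analyticAt] with s hs hFs hPs hQs hHs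
  have hs' : (0 : ℝ) < s := hs
  have hs0 : (s : ℂ) ≠ 0 := by exact_mod_cast hs'.ne'
  rw [nhdsWithin_eq_nhds.2 (Ioi_mem_nhds hs')] at hFs
  have dP := hPs.differentiableAt.hasDerivAt.comp_ofReal
  have dQ := hQs.differentiableAt.hasDerivAt.comp_ofReal
  have dH := hasDerivAt_comp_ofReal_cpow_pair hs' hHs.differentiableAt
  have dw : HasDerivAt (fun t : ℝ => (t : ℂ) ^ κ) (κ * (s : ℂ) ^ (κ - 1) * 1) s :=
    ((hasDerivAt_id (s : ℂ)).cpow_const (c := κ) (Complex.ofReal_mem_slitPlane.2 hs')).comp_ofReal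
  refine ⟨_, ((dP.add ((dw.const_mul β).mul dQ)).add ((dw.pow 2).mul dH)).congr_of_eventuallyEq hFs,
    ?_⟩
  rw [Complex.cpow_sub _ _ hs0, Complex.cpow_one]
  field_simp
  push_cast
  simp only [Pi.pow_apply]
  ring

/-- The power s^ν adds the constant ν, and s F'/F is a quotient of two expansions in w = s^κ. Since
s d/ds multiplies s^κ by κ and P(0) = 1, the leading singular coefficient is multiplied by κ while
c₁ is unchanged. -/
theorem hasSmallExpansion_logDeriv {κ β ν c₁ : ℂ} {P Q : ℂ → ℂ} {H : ℂ × ℂ → ℂ} {F : ℝ → ℂ}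
    (hκ : 0 < κ.re) (hP : AnalyticAt ℂ P 0) (hP0 : P 0 = 1) (hP1 : HasDerivAt P c₁ 0)
    (hQ : AnalyticAt ℂ Q 0) (hQ0 : Q 0 ≠ 0) (hH : AnalyticAt ℂ H (0, 0))
    (hF : ∀ᶠ s : ℝ in 𝓝[>] 0, F s = P s + β * (s : ℂ) ^ κ * Q s +
      ((s : ℂ) ^ κ) ^ 2 * H ((s : ℂ), (s : ℂ) ^ κ)) :
    (∀ᶠ s : ℝ in 𝓝[>] 0, DifferentiableAt ℝ F s ∧ F s ≠ 0) ∧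
    HasSmallExpansion κ ν c₁ (κ * (β * Q 0))
      (fun s : ℝ => (s : ℂ) * logDeriv (fun t : ℝ => (t : ℂ) ^ ν * F t) s) := by
  have hpair := tendsto_ofReal_cpow_pair hκ
  have hfst : Tendsto (fun s : ℝ => (s : ℂ)) (𝓝[>] 0) (𝓝 0) :=
    (continuous_fst.tendsto (0, 0)).comp hpair
  have hder := eventually_hasDerivAt_expansion hκ hP hQ hH hF
  set D : ℂ × ℂ → ℂ := fun p => P p.1 + β * p.2 * Q p.1 + p.2 ^ 2 * H p with hD
  have hw : AnalyticAt ℂ (fun p : ℂ × ℂ => p.2) (0, 0) := analyticAt_snd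
  have hz : AnalyticAt ℂ (fun p : ℂ × ℂ => p.1) (0, 0) := analyticAt_fst
  have hDan : AnalyticAt ℂ D (0, 0) :=
    (hP.comp_fst_zero.fun_add ((analyticAt_const.fun_mul hw).fun_mul hQ.comp_fst_zero)).fun_add
      ((hw.fun_pow 2).fun_mul hH)
  have hD0 : D (0, 0) ≠ 0 := by simp [hD, hP0]
  have hP0' : P 0 ≠ 0 := by simp [hP0]
  have hDne : ∀ᶠ s : ℝ in 𝓝[>] 0, D ((s : ℂ), (s : ℂ) ^ κ) ≠ 0 :=
    hpair.eventually (hDan.continuousAt.eventually_ne hD0)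
  have hPne : ∀ᶠ s : ℝ in 𝓝[>] 0, P s ≠ 0 :=
    hfst.eventually (hP.continuousAt.eventually_ne hP0')
  refine ⟨?_, ?_⟩
  · filter_upwards [hder, hDne, hF] with s ⟨F', h1, _⟩ h2 h3
    exact ⟨h1.differentiableAt, by rw [h3]; exact h2⟩
  -- Division to first order in w: p₀ and q are chosen so that the numerator minus (p₀ + β w q) D is
  -- divisible by w². The quotient by w² D is K.
  set p₀ : ℂ → ℂ := fun z => z * deriv P z / P z with hp₀
  set q : ℂ → ℂ := fun z => ((z * deriv Q z + κ * Q z) - p₀ z * Q z) / P z with hq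
  set G : ℂ × ℂ → ℂ := fun p => p.1 * fderiv ℂ H p (1, 0) + κ * p.2 * fderiv ℂ H p (0, 1) +
    2 * κ * H p with hG
  set K : ℂ × ℂ → ℂ := fun p =>
    (G p - H p * p₀ p.1 - β ^ 2 * Q p.1 * q p.1 - p.2 * (β * (H p * q p.1))) / D p with hK
  have hid : AnalyticAt ℂ (fun z : ℂ => z) 0 := analyticAt_id
  have ap₀ : AnalyticAt ℂ p₀ 0 := (hid.fun_mul hP.deriv).fun_div hP hP0'
  have aq : AnalyticAt ℂ q 0 :=
    (((hid.fun_mul hQ.deriv).fun_add (analyticAt_const.fun_mul hQ)).fun_sub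
      (ap₀.fun_mul hQ)).fun_div hP hP0'
  have aG : AnalyticAt ℂ G (0, 0) :=
    ((hz.fun_mul (analyticAt_fderiv_apply hH _)).fun_add
      ((analyticAt_const.fun_mul hw).fun_mul (analyticAt_fderiv_apply hH _))).fun_add
      (analyticAt_const.fun_mul hH)
  have aK : AnalyticAt ℂ K (0, 0) :=
    ((((aG.fun_sub (hH.fun_mul ap₀.comp_fst_zero)).fun_sub
      ((analyticAt_const.fun_mul hQ.comp_fst_zero).fun_mul aq.comp_fst_zero)).fun_sub
      (hw.fun_mul (analyticAt_const.fun_mul (hH.fun_mul aq.comp_fst_zero)))).fun_div hDan hD0)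
  have hq0 : q 0 = κ * Q 0 := by simp [hq, hp₀, hP0]
  have hκ0 : κ ≠ 0 := fun h => by simp [h] at hκ
  have hderiv : HasDerivAt (fun z => ν + p₀ z) c₁ 0 := by
    have h1 := (((hasDerivAt_id (0 : ℂ)).mul hP.deriv.differentiableAt.hasDerivAt).div hP1
      hP0').const_add ν
    refine h1.congr_deriv ?_
    simp [hP0, hP1.deriv]
  have main := hasSmallExpansion_of_eventually (κ := κ) (β := β) (P := fun z => ν + p₀ z) (Q := q)
    (H := K) (F := fun s : ℝ => (s : ℂ) * logDeriv (fun t : ℝ => (t : ℂ) ^ ν * F t) s) hκ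
    (analyticAt_const.fun_add ap₀) hderiv aq (by rw [hq0]; exact mul_ne_zero hκ0 hQ0) aK ?_
  · convert main using 1
    · simp [hp₀]
    · rw [hq0]; ring
  · filter_upwards [self_mem_nhdsWithin, hder, hDne, hPne, hF] with s hs ⟨F', h1, h2⟩ h3 h4 h5
    have hs' : (0 : ℝ) < s := hs
    have hs0 : (s : ℂ) ≠ 0 := by exact_mod_cast hs'.ne'
    have hFne : F s ≠ 0 := by rw [h5]; exact h3
    have dw : HasDerivAt (fun t : ℝ => (t : ℂ) ^ ν) (ν * (s : ℂ) ^ (ν - 1) * 1) s :=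
      ((hasDerivAt_id (s : ℂ)).cpow_const (c := ν) (Complex.ofReal_mem_slitPlane.2 hs')).comp_ofReal
    have hwne : (s : ℂ) ^ ν ≠ 0 := by simp [Complex.cpow_eq_zero_iff, hs0]
    have e1 : (s : ℂ) * logDeriv (fun t : ℝ => (t : ℂ) ^ ν * F t) s = ν + s * F' / F s := by
      rw [logDeriv_apply, (dw.fun_mul h1).deriv, Complex.cpow_sub _ _ hs0, Complex.cpow_one]
      field_simp
    rw [e1, h2]
    have e2 : F s = D ((s : ℂ), (s : ℂ) ^ κ) := h5
    have e3 : p₀ s * P s = s * deriv P s := by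
      simp only [hp₀]; field_simp
    have e4 : q s * P s = (s * deriv Q s + κ * Q s) - p₀ s * Q s := by
      simp only [hq]; field_simp
    have e5 : K ((s : ℂ), (s : ℂ) ^ κ) * D ((s : ℂ), (s : ℂ) ^ κ) =
        G ((s : ℂ), (s : ℂ) ^ κ) - H ((s : ℂ), (s : ℂ) ^ κ) * p₀ s - β ^ 2 * Q s * q s -
          (s : ℂ) ^ κ * (β * (H ((s : ℂ), (s : ℂ) ^ κ) * q s)) := by
      simp only [hK]; field_simp
    have e6 : D ((s : ℂ), (s : ℂ) ^ κ) = P s + β * (s : ℂ) ^ κ * Q s +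
      ((s : ℂ) ^ κ) ^ 2 * H ((s : ℂ), (s : ℂ) ^ κ) := rfl
    have e7 : G ((s : ℂ), (s : ℂ) ^ κ) = s * fderiv ℂ H ((s : ℂ), (s : ℂ) ^ κ) (1, 0) +
      κ * (s : ℂ) ^ κ * fderiv ℂ H ((s : ℂ), (s : ℂ) ^ κ) (0, 1) +
      2 * κ * H ((s : ℂ), (s : ℂ) ^ κ) := rfl
    rw [e2, ← e7, add_assoc ν, add_assoc ν, add_right_inj, add_assoc (p₀ s), div_eq_iff h3]
    have e8 : (p₀ s + (β * (s : ℂ) ^ κ * q s + ((s : ℂ) ^ κ) ^ 2 * K ((s : ℂ), (s : ℂ) ^ κ))) *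
        D ((s : ℂ), (s : ℂ) ^ κ) = (p₀ s + β * (s : ℂ) ^ κ * q s) * D ((s : ℂ), (s : ℂ) ^ κ) +
        ((s : ℂ) ^ κ) ^ 2 * (K ((s : ℂ), (s : ℂ) ^ κ) * D ((s : ℂ), (s : ℂ) ^ κ)) := by ring
    rw [e8, e5, e6]
    linear_combination -e3 - β * (s : ℂ) ^ κ * e4

/-! ### Assembly -/

theorem exists_lueE_expansion (N : ℕ) (hN : 1 ≤ N) {a μ : ℂ} (ξ : ℂ) (hμ : -1 < μ.re)
    (ha : -1 < a.re) (hμa : -1 < (a + μ).re) (hκ : ∀ n : ℤ, a + μ + 1 ≠ n) :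
    ∃ (P Q : ℂ → ℂ) (H : ℂ × ℂ → ℂ), AnalyticAt ℂ P 0 ∧ P 0 = 1 ∧
      HasDerivAt P (-(μ * N / (a + μ))) 0 ∧ AnalyticAt ℂ Q 0 ∧
      Q 0 = Complex.Gamma (a + μ + 1 + N) / (Complex.Gamma (a + μ + 2) *
        Complex.Gamma (a + μ + 1) * Complex.Gamma N) ∧
      AnalyticAt ℂ H (0, 0) ∧
      ∀ᶠ s : ℝ in 𝓝[>] 0, lueE N a μ ξ s = P s +
        totBeta μ ((1 - ξ) * Complex.exp (Real.pi * Complex.I * μ)) a *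
          (s : ℂ) ^ (a + μ + 1) * Q s +
          ((s : ℂ) ^ (a + μ + 1)) ^ 2 * H ((s : ℂ), (s : ℂ) ^ (a + μ + 1)) := by
  set κ := a + μ + 1 with hκdef
  set β := totBeta μ ((1 - ξ) * Complex.exp (Real.pi * Complex.I * μ)) a with hβ
  have hκre : 0 < κ.re := by simp [hκdef] at hμa ⊢; linarith
  have hC0 : lueC N (a + μ) ≠ 0 := lueC_ne_zero N hμa
  have hκn : ∀ m : ℕ, ∀ n : ℤ, κ + m ≠ n := fun m n h => hκ (n - m) (by
    push_cast; linear_combination h)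
  set A : ℂ → Matrix (Fin N) (Fin N) ℂ := fun z => Matrix.of fun j k =>
    momentA μ (κ + ((j : ℕ) + (k : ℕ) : ℕ)) z with hA
  set B : ℂ → Matrix (Fin N) (Fin N) ℂ := fun z => Matrix.of fun j k =>
    z ^ ((j : ℕ) + (k : ℕ)) * momentB μ a ((j : ℕ) + k) z with hB
  have aA : ∀ j k, AnalyticAt ℂ (fun z => A z j k) 0 := fun j k =>
    analyticAt_momentA μ (hκn _)
  have aB : ∀ j k, AnalyticAt ℂ (fun z => B z j k) 0 := fun j k =>
    (analyticAt_id.fun_pow _).fun_mul (analyticAt_momentB hκ _)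
  obtain ⟨P, Q, hJ⟩ := exists_hasJet_det aA aB
  have hPdet : P =ᶠ[𝓝 0] fun z => (A z).det := by
    filter_upwards [hJ.eventually_eq_fst] with z hz
    rw [hz]
    congr 1
    ext j k
    simp
  have hA0 : A 0 = Matrix.of fun j k : Fin N =>
      Complex.Gamma (κ + ((j : ℕ) + (k : ℕ) : ℕ)) := by
    ext j k
    simp [hA, momentA_zero]
  have hκnat : ∀ m : ℕ, κ ≠ -m := fun m h => hκ (-m) (by push_cast; exact h)
  have hC : lueC N (a + μ) = ∏ j ∈ Finset.range N,
      Complex.Gamma ((j : ℂ) + 1) * Complex.Gamma ((j : ℂ) + κ) := by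
    simp only [lueC, hκdef, add_assoc]
  have hdetA0 : (A 0).det = lueC N (a + μ) := by
    rw [hA0, det_Gamma_hankel N κ hκnat, hC]
  -- Differentiating row i at 0 replaces Γ(κ + i + k) by -μ Γ(κ - 1 + i + k), so the row-replacement
  -- sum applies with y = κ - 1 = a + μ.
  have hPd : HasDerivAt P (-(μ * N / (a + μ)) * lueC N (a + μ)) 0 := by
    have h1 : ∀ j k : Fin N, HasDerivAt (fun z => A z j k)
        (-μ * Complex.Gamma (a + μ + ((j : ℕ) + (k : ℕ) : ℕ))) 0 := fun j k => by
      have := hasDerivAt_momentA μ (hκn ((j : ℕ) + k))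
      rw [show κ + ((j : ℕ) + (k : ℕ) : ℕ) - 1 = a + μ + ((j : ℕ) + (k : ℕ) : ℕ) by
        rw [hκdef]; ring] at this
      exact this
    have h2 := hasDerivAt_det (M' := Matrix.of fun j k : Fin N =>
      -μ * Complex.Gamma (a + μ + ((j : ℕ) + (k : ℕ) : ℕ))) h1
    refine (h2.congr_of_eventuallyEq hPdet).congr_deriv ?_
    have h3 : ∀ i : Fin N, ((A 0).updateRow i ((Matrix.of fun j k : Fin N =>
        -μ * Complex.Gamma (a + μ + ((j : ℕ) + (k : ℕ) : ℕ))) i)).det =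
        -μ * ((A 0).updateRow i (fun k => Complex.Gamma (a + μ + ((i : ℕ) + (k : ℕ) : ℕ)))).det :=
      fun i => (A 0).det_updateRow_smul i (-μ) _
    simp only [h3]
    rw [← Finset.mul_sum, hA0, sum_det_updateRow_Gamma_hankel N hN (a + μ) fun m h => hκ (1 - m) (by
      push_cast; linear_combination h), hC]
    ring
  have hQ0 : Q 0 = Complex.Gamma (κ + N) / (Complex.Gamma (a + μ + 2) *
        Complex.Gamma κ * Complex.Gamma N) * lueC N (a + μ) := by
    obtain ⟨n, rfl⟩ : ∃ n, N = n + 1 := ⟨N - 1, by omega⟩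
    -- The factor z^{j+k} leaves only the corner entry at z = 0.
    have hB0 : ∀ j k, B 0 j k = if j = 0 ∧ k = 0 then 1 else 0 := fun j k => by
      by_cases h : j = 0 ∧ k = 0
      · simp [hB, h, momentB_zero_zero]
      · have : (j : ℕ) + k ≠ 0 := fun h0 => h ⟨Fin.ext (by rw [Fin.val_zero]; omega), Fin.ext (by rw [Fin.val_zero]; omega)⟩
        rw [if_neg h]
        simp only [hB, Matrix.of_apply, zero_pow this, zero_mul]
    have h1 := hJ.snd_zero_eq (fun w => det_add_smul_single (A 0) (B 0) hB0 w)
    have h2 : (A 0).submatrix Fin.succ Fin.succ = Matrix.of fun j k : Fin n =>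
        Complex.Gamma (κ + 2 + ((j : ℕ) + (k : ℕ) : ℕ)) := by
      ext j k
      rw [hA0]
      simp only [Matrix.submatrix_apply, Matrix.of_apply, Fin.val_succ]
      push_cast
      ring_nf
    rw [h1, h2, det_Gamma_hankel n (κ + 2) fun m h => hκ (-(m + 2)) (by
      push_cast; linear_combination h), hC]
    have h3 := lueC_succ_ratio n κ
    have g1 : Complex.Gamma (κ + 1) ≠ 0 := Complex.Gamma_ne_zero_of_re_pos (by
      rw [Complex.add_re, Complex.one_re]; linarith)
    have g2 : Complex.Gamma κ ≠ 0 := Complex.Gamma_ne_zero_of_re_pos hκre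
    have g3 : Complex.Gamma ((n : ℂ) + 1) ≠ 0 := by
      rw [Complex.Gamma_nat_eq_factorial]
      exact_mod_cast n.factorial_ne_zero
    rw [show a + μ + 2 = κ + 1 by rw [hκdef]; ring, div_mul_eq_mul_div, eq_div_iff]
    · push_cast
      rw [← add_assoc]
      exact h3
    · push_cast
      exact mul_ne_zero (mul_ne_zero g1 g2) g3
  obtain ⟨hP, hQ, H, hH, hΦ⟩ := hJ
  set C := lueC N (a + μ) with hCdef
  -- The jet variable is w = β s^κ; rewriting in terms of s^κ moves β² into H.
  refine ⟨fun z => P z / C, fun z => Q z / C, fun p => β ^ 2 * H (p.1, β * p.2) / C,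
    hP.fun_div analyticAt_const hC0, ?_, ?_, hQ.fun_div analyticAt_const hC0, ?_, ?_, ?_⟩
  · simp only [hPdet.self_of_nhds, hdetA0, div_self hC0]
  · refine (hPd.div_const C).congr_deriv ?_
    rw [mul_div_cancel_right₀ _ hC0]
  · simp only [hQ0, mul_div_cancel_right₀ _ hC0]
  · have h1 : AnalyticAt ℂ (fun p : ℂ × ℂ => H (p.1, β * p.2)) (0, 0) := by
      refine AnalyticAt.fun_comp (f := fun p : ℂ × ℂ => (p.1, β * p.2)) (x := (0, 0))
        (by simpa using hH) ?_
      exact analyticAt_fst.prod (analyticAt_const.fun_mul analyticAt_snd)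
    exact (analyticAt_const.fun_mul h1).fun_div analyticAt_const hC0
  · obtain ⟨δ, hδ, h⟩ := exists_le_norm_add_int hκ
    have ht : Tendsto (fun p : ℂ × ℂ => (p.1, β * p.2)) (𝓝 (0, 0)) (𝓝 (0, 0)) :=
      Continuous.tendsto' (by fun_prop) _ _ (by simp)
    have hev := (ht.comp (tendsto_ofReal_cpow_pair hκre)).eventually hΦ
    filter_upwards [self_mem_nhdsWithin, hev,
      Ioo_mem_nhdsGT (half_pos hδ)] with s hs hs1 hs2
    have hs' : (0 : ℝ) < s := hs
    rw [lueE_eq_det N ha hμ ξ hs', ← hCdef]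
    have e : (Matrix.of fun j k : Fin N =>
        ∫ x in Set.Ioi (0 : ℝ), (x : ℂ) ^ ((j : ℕ) + k) * deformedWeight a μ ξ s x) =
        Matrix.of fun j k => A s j k + β * (s : ℂ) ^ κ * B s j k := by
      ext j k
      simp only [Matrix.of_apply]
      rw [integral_deformedWeight ha hμ ξ hδ h _ hs' hs2.2.le]
      rfl
    rw [e]
    simp only [Function.comp] at hs1
    rw [hs1]
    ring

theorem mainTheorem1 (N : ℕ) (hN : 1 ≤ N) (a μ ξ : ℂ)
    (hμ : -1 < μ.re) (ha : -1 < a.re) (hμa : -1 < (μ + a).re)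
    (hgen : ∀ n : ℕ, μ + a ≠ (n : ℂ)) :
    HasSmallExpansion (μ + a + 1) 1 (-(μ * N / (μ + a)))
      (Complex.Gamma (μ + 1) * Complex.Gamma (a + 1) * Complex.Gamma (μ + a + N + 1) /
          (Complex.Gamma (μ + a + 2) ^ 2 * Complex.Gamma (μ + a + 1) * Complex.Gamma N) *
        ((1 - ξ) * Complex.exp (Real.pi * Complex.I * μ) -
          Complex.sin (Real.pi * a) / Complex.sin (Real.pi * (μ + a))))
      (lueE N a μ ξ) ∧
    (∀ᶠ s : ℝ in 𝓝[>] 0, DifferentiableAt ℝ (lueE N a μ ξ) s ∧ lueE N a μ ξ s ≠ 0) ∧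
    HasSmallExpansion (μ + a + 1) (-((N : ℂ) * μ)) (-(μ * N / (μ + a)))
      (Complex.Gamma (μ + 1) * Complex.Gamma (a + 1) * Complex.Gamma (μ + a + N + 1) /
          (Complex.Gamma (μ + a + 2) * Complex.Gamma (μ + a + 1) ^ 2 * Complex.Gamma N) *
        ((1 - ξ) * Complex.exp (Real.pi * Complex.I * μ) -
          Complex.sin (Real.pi * a) / Complex.sin (Real.pi * (μ + a))))
      (lueW N a μ ξ) := by
  -- Re(a + μ + 1) > 0 leaves only positive integers to exclude, and those are covered by μ + a not
  -- being a nonnegative integer.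
  have hκ : ∀ n : ℤ, a + μ + 1 ≠ n := by
    intro n hn
    have h1 : (0 : ℝ) < n := by
      have := congrArg Complex.re hn
      simp at this hμa
      linarith
    have h2 : 0 < n := by exact_mod_cast h1
    obtain ⟨k, rfl⟩ : ∃ k : ℕ, n = k + 1 := ⟨(n - 1).toNat, by omega⟩
    apply hgen k
    push_cast at hn
    linear_combination hn
  have hκre : 0 < (a + μ + 1).re := by simp at hμa ⊢; linarith
  obtain ⟨P, Q, H, hP, hP0, hP1, hQ, hQ0, hH, hF⟩ :=
    exists_lueE_expansion N hN ξ hμ ha (by rwa [add_comm]) hκ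
  have hN0 : (0 : ℝ) < N := by exact_mod_cast hN
  have g1 : Complex.Gamma (a + μ + 2) ≠ 0 := Complex.Gamma_ne_zero_of_re_pos (by
    simp at hμa ⊢; linarith)
  have g2 : Complex.Gamma (a + μ + 1) ≠ 0 := Complex.Gamma_ne_zero_of_re_pos hκre
  have g3 : Complex.Gamma N ≠ 0 := Complex.Gamma_ne_zero_of_re_pos (by simpa using hN0)
  have g4 : Complex.Gamma (a + μ + 1 + N) ≠ 0 := Complex.Gamma_ne_zero_of_re_pos (by
    simp at hμa ⊢; linarith)
  have hQne : Q 0 ≠ 0 := by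
    rw [hQ0]
    exact div_ne_zero g4 (mul_ne_zero (mul_ne_zero g1 g2) g3)
  have hβ := totBeta_eq ha hμ hκ ((1 - ξ) * Complex.exp (Real.pi * Complex.I * μ))
  have hE := hasSmallExpansion_of_eventually hκre hP hP1 hQ hQne hH hF
  have hW := hasSmallExpansion_logDeriv (ν := -((N : ℂ) * μ)) hκre hP hP0 hP1 hQ hQne hH hF
  -- The factor κ gained by the logarithmic derivative turns one Γ(κ + 1) in the denominator into
  -- Γ(κ), which accounts for the different squares in the two constants.
  have hΓ : Complex.Gamma (a + μ + 2) = (a + μ + 1) * Complex.Gamma (a + μ + 1) := by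
    rw [← Complex.Gamma_add_one _ (by simpa using hκ 0)]
    ring_nf
  have e4 : μ + a + N + 1 = a + μ + 1 + N := by ring
  rw [hβ, hQ0, add_comm μ a] at hE hW
  rw [hP0] at hE
  rw [e4, add_comm μ a]
  refine ⟨?_, hW.1, ?_⟩
  · convert hE using 1
    field_simp
  · convert hW.2 using 1
    · rw [hΓ]
      have hk0 : a + μ + 1 ≠ 0 := by simpa using hκ 0
      field_simp
    · rfl

end
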